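/- **Corollary 5.3 (comparing tilt-stability and strong regularity).** Let $0\le s\le m$, let $\varphi_0,\varphi_1,\dots,\varphi_m:\mathbb R^n\to\mathbb R$, and consider the nonlinear program $$\text{minimize }\varphi_0(x)\quad\text{subject to}\quad \varphi_i(x)\le 0\ (i=1,\dots,s),\qquad \varphi_i(x)=0\ (i=s+1,\dots,m),$$ with feasible set $X$. Put $\varphi(x):=\varphi_0(x)$ for $x\in X$ and $\varphi(x):=\infty$ for $x\notin X$. Let $\bar x\in X$ be such that each $\varphi_i$, $i=0,\dots,m$, is continuously differentiable around $\bar x$ with $\nabla\varphi_i$ strictly differentiable at $\bar x$, and such that LICQ holds at $\bar x$: the gradients $\nabla\varphi_i(\bar x)$ of the active constraints (those $i\ge1$ with $\varphi_i(\bar x)=0$) are linearly independent. Let $L(x,\lambda):=\varphi_0(x)+\sum_{i=1}^m\lambda_i\varphi_i(x)$. The point $\bar x$ is a *tilt-stable local minimizer* if there is $\gamma>0$ such that the mapping $$M(y):=\operatorname{argmin}\{\varphi(x)-\varphi(\bar x)-\langle y,x-\bar x\rangle : \|x-\bar x\|\le\gamma\}$$ is single-valued and Lipschitz continuous on some neighborhood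 of $y=0$, with $M(0)=\bar x$. Every tilt-stable local minimizer is a local minimizer of $\varphi_0$ over $X$. Suppose that $\bar x$ is a local minimizer of $\varphi_0$ over $X$. Then there is a unique multiplier vector $\bar\lambda\in\mathbb R^s_+\times\mathbb R^{m-s}$ with $\nabla_xL(\bar x,\bar\lambda)=0$ and $\bar\lambda_i\varphi_i(\bar x)=0$ for $i=1,\dots,s$, and the following are equivalent: * $\bar x$ is a tilt-stable local minimizer; * the variational inequality associated with the KKT conditions, $$0\in f(z)+N_C(z),\qquad z=(x,\lambda),\quad f(x,\lambda)=\big(\nabla_xL(x,\lambda),-\varphi_1(x),\dots,-\varphi_m(x)\big),\quad C=\mathbb R^n\times\mathbb R^s_+\times\mathbb R^{m-s},$$ is strongly regular in Robinson's sense at its solution $\bar z=(\bar x,\bar\lambda)$. Here $N_C(z)$ is the normal cone of convex analysis (empty if $z\notin C$), and strong regularity at $\bar z$ means that $f$ is differentiable at $\bar z$ and there are neighborhoods $U$ of $0$ and $V$ of $\bar z$ such that, for each $y\in U$, the linearized inclusion $y\in f(\bar z)+f'(\bar z)(z-\bar z)+N_C(z)$ has exactly one solution $z$ in $V$, and this solution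 is a Lipschitz continuous function of $y\in U$. -/

import Mathlib

open scoped Topology NNReal

noncomputable section

namespace TiltNLP

section General

variable {E : Type*} [NormedAddCommGroup E] [InnerProductSpace ℝ E]

/-- The tilted argmin set
`M(y) = argmin {φ(x) - φ(x̄) - ⟨y, x - x̄⟩ : ‖x - x̄‖ ≤ γ}` of an extended-real-valued function. -/
def tiltArgmin (φ : E → EReal) (xbar : E) (γ : ℝ) (y : E) : Set E :=
  {x | ‖x - xbar‖ ≤ γ ∧ ∀ x', ‖x' - xbar‖ ≤ γ →
    φ x - φ xbar - ((inner ℝ y (x - xbar) : ℝ) : EReal) ≤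
      φ x' - φ xbar - ((inner ℝ y (x' - xbar) : ℝ) : EReal)}

/-- `x̄` is a tilt-stable local minimizer of `φ` (finite at `x̄`): for some `γ > 0` the mapping
`y ↦ M(y)` is single-valued and Lipschitz continuous on a neighborhood of `0`, with `M(0) = x̄`. -/
def IsTiltStableLocalMin (φ : E → EReal) (xbar : E) : Prop :=
  φ xbar ≠ ⊤ ∧ φ xbar ≠ ⊥ ∧
    ∃ γ : ℝ, 0 < γ ∧ ∃ U ∈ 𝓝 (0 : E), ∃ (σ : E → E) (K : ℝ≥0),
      LipschitzOnWith K σ U ∧ σ 0 = xbar ∧ ∀ y ∈ U, tiltArgmin φ xbar γ y = {σ y}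

/-- The normal cone of convex analysis; it is empty at points outside `C`. -/
def normalCone (C : Set E) (z : E) : Set E :=
  {v | z ∈ C ∧ ∀ z' ∈ C, inner ℝ v (z' - z) ≤ 0}

/-- `z` solves the variational inequality `0 ∈ f(z) + N_C(z)`. -/
def SolvesVI (f : E → E) (C : Set E) (z : E) : Prop :=
  -f z ∈ normalCone C z

/-- Robinson's strong regularity of the variational inequality `0 ∈ f(z) + N_C(z)` at its
solution `z̄`: there are neighborhoods `U` of `0` and `V` of `z̄` such that assigning to `y ∈ U` the
solutions `z ∈ V` of the linearized inclusion `y ∈ f(z̄) + f'(z̄)(z - z̄) + N_C(z)` is a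
single-valued and Lipschitz continuous mapping on `U`. -/
def IsStronglyRegular (f : E → E) (C : Set E) (zbar : E) : Prop :=
  SolvesVI f C zbar ∧ ∃ A : E →L[ℝ] E, HasFDerivAt f A zbar ∧
    ∃ U ∈ 𝓝 (0 : E), ∃ V ∈ 𝓝 zbar, ∃ (σ : E → E) (K : ℝ≥0),
      LipschitzOnWith K σ U ∧
        ∀ y ∈ U, {z ∈ V | y - (f zbar + A (z - zbar)) ∈ normalCone C z} = {σ y}

end General

variable {n m : ℕ}

/-- The feasible set of a nonlinear program whose first `s` constraints are the inequalities
`φᵢ(x) ≤ 0` and whose remaining constraints are the equalities `φᵢ(x) = 0`. -/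
def feasibleSet (s : ℕ) (φ : Fin m → EuclideanSpace ℝ (Fin n) → ℝ) :
    Set (EuclideanSpace ℝ (Fin n)) :=
  {x | ∀ i : Fin m, ((i : ℕ) < s → φ i x ≤ 0) ∧ (s ≤ (i : ℕ) → φ i x = 0)}

open Classical in
/-- The extended-real-valued objective: `φ₀` plus the indicator function of the feasible set. -/
def extendedObjective (s : ℕ) (φ₀ : EuclideanSpace ℝ (Fin n) → ℝ)
    (φ : Fin m → EuclideanSpace ℝ (Fin n) → ℝ) (x : EuclideanSpace ℝ (Fin n)) : EReal :=
  if x ∈ feasibleSet s φ then ((φ₀ x : ℝ) : EReal) else ⊤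

/-- `f` is continuously differentiable around `x` and its derivative, represented by the gradient,
is strictly differentiable at `x`. -/
def SmoothWithStrictGradient (f : EuclideanSpace ℝ (Fin n) → ℝ)
    (x : EuclideanSpace ℝ (Fin n)) : Prop :=
  ContDiffAt ℝ 1 f x ∧
    ∃ H : EuclideanSpace ℝ (Fin n) →L[ℝ] EuclideanSpace ℝ (Fin n),
      HasStrictFDerivAt (gradient f) H x

/-- The linear independence constraint qualification: the gradients at `x` of the constraints
active at `x` are linearly independent. -/
def LICQ (φ : Fin m → EuclideanSpace ℝ (Fin n) → ℝ) (x : EuclideanSpace ℝ (Fin n)) : Prop :=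
  LinearIndependent ℝ (fun i : {i : Fin m // φ i x = 0} => gradient (φ i) x)

/-- The Lagrangian `L(x, μ) = φ₀(x) + ∑ μᵢ φᵢ(x)`. -/
def lagrangian (φ₀ : EuclideanSpace ℝ (Fin n) → ℝ) (φ : Fin m → EuclideanSpace ℝ (Fin n) → ℝ)
    (x : EuclideanSpace ℝ (Fin n)) (μ : EuclideanSpace ℝ (Fin m)) : ℝ :=
  φ₀ x + ∑ i, μ i * φ i x

/-- `μ` is a Lagrange multiplier vector at the feasible point `x`: `∇ₓL(x, μ) = 0`, the
multipliers of the inequality constraints are nonnegative, and they vanish for the inactive ones. -/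
def IsMultiplier (s : ℕ) (φ₀ : EuclideanSpace ℝ (Fin n) → ℝ)
    (φ : Fin m → EuclideanSpace ℝ (Fin n) → ℝ) (x : EuclideanSpace ℝ (Fin n))
    (μ : EuclideanSpace ℝ (Fin m)) : Prop :=
  gradient φ₀ x + ∑ i, μ i • gradient (φ i) x = 0 ∧
    ∀ i : Fin m, (i : ℕ) < s → 0 ≤ μ i ∧ μ i * φ i x = 0

/-- The space `ℝⁿ × ℝᵐ` of primal-dual pairs with its Euclidean structure. -/
abbrev PrimalDual (n m : ℕ) : Type :=
  WithLp 2 (EuclideanSpace ℝ (Fin n) × EuclideanSpace ℝ (Fin m))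

/-- The mapping `(x, μ) ↦ (∇ₓL(x, μ), -φ₁(x), …, -φₘ(x))` of the variational inequality
associated with the Karush-Kuhn-Tucker conditions. -/
def kktMap (φ₀ : EuclideanSpace ℝ (Fin n) → ℝ) (φ : Fin m → EuclideanSpace ℝ (Fin n) → ℝ)
    (z : PrimalDual n m) : PrimalDual n m :=
  WithLp.toLp 2 (gradient (fun x => lagrangian φ₀ φ x z.snd) z.fst,
    WithLp.toLp 2 (fun i => -φ i z.fst))

/-- The polyhedral set `ℝⁿ × ℝˢ₊ × ℝᵐ⁻ˢ` of the same variational inequality. -/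
def kktSet (n m s : ℕ) : Set (PrimalDual n m) :=
  {z | ∀ i : Fin m, (i : ℕ) < s → 0 ≤ z.snd i}

end TiltNLP

end

/-!
Both properties are equivalent to the strong second-order condition: the Hessian `H` of the
Lagrangian `L(·, μ̄)` at `x̄` is positive definite on the subspace of directions orthogonal to the
gradients of the equality constraints and of the inequality constraints with positive multiplier.
Linear independence of the active gradients is used through a biorthogonal family `b`
(`IsDualOn`): it straightens the constraints (`exists_straightening`), gives the multipliers
(`exists_multiplier_of_isDualOn`), and shows that the critical cone `K` spans that subspace as a
difference set (`exists_sub_mem_criticalCone`).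

*From the second-order condition.* The estimate `exists_stability_estimate` bounds primal and dual
increments of an approximate solution of the linearized complementarity system by its residual.
Applied without remainder it gives Lipschitz continuity of the linearized solutions, which exist
because a coercive quadratic attains its minimum over `K` (`IsRegularKKT.isStronglyRegular`).
Applied to differences of solutions of the nonlinear Karush-Kuhn-Tucker systems for two tilts, with a
remainder controlled by strict differentiability, it gives Lipschitz continuity and uniqueness of
the tilted minimizers, which exist by compactness (`IsRegularKKT.isTiltStableLocalMin`).

*To the second-order condition.* Let `q_p(d) = ½⟨Hd, d⟩ - ⟨p, d⟩`. If every `d ∈ K` is the unique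
minimizer of `q_p` over `K` for the tilt `p = Hd`, then `q_p(d') - q_p(d) = ½⟨H(d' - d), d' - d⟩` is
positive for all `d' ≠ d` in `K`, so `H` is positive definite on `K - K`
(`inner_pos_of_argmin_apply_self`). That hypothesis is verified in two ways.

* Under tilt stability, rescaled tilted minimizers converge to minimizers `D p` of `q_p` over `K`
  that are Lipschitz continuous in `p` (`IsRegularKKT.exists_lipschitz_argmin`). Monotonicity makes them
  the only minimizers, and solving `p + r D p = Hd + r d` for large `r`, a monotone Lipschitz
  equation, yields `D (Hd) = d` (`lipschitz_argmin_apply_self`).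
* Under strong regularity, the solutions of the stationarity system of `q_p` over `K` are Lipschitz
  continuous in `p`. By the second-order necessary condition `H` is nonnegative on `K`, so the
  minimizers for `H + ε` exist, and they converge to `d` as `ε ↓ 0`
  (`argmin_apply_self_of_isCriticalTriple_lipschitz`).
-/

namespace TiltNLP

open Filter Asymptotics
open scoped InnerProductSpace

/-! ### Biorthogonal families, multipliers and the perturbed second-order system -/

section DualFamily

variable {E : Type*} [NormedAddCommGroup E] [InnerProductSpace ℝ E]
variable {ι : Type*} [DecidableEq ι]

/-- The family `b` is biorthogonal to `a` over the finite index set `A`. Such a family exists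
exactly when the `a i`, `i ∈ A`, are linearly independent; it is the form in which the constraint
qualification is used throughout. Values outside `A` are irrelevant. -/
def IsDualOn (A : Finset ι) (a b : ι → E) : Prop :=
  ∀ i ∈ A, ∀ j ∈ A, ⟪a i, b j⟫_ℝ = if i = j then 1 else 0

theorem IsDualOn.mono {A B : Finset ι} {a b : ι → E} (h : IsDualOn A a b) (hBA : B ⊆ A) :
    IsDualOn B a b :=
  fun i hi j hj => h i (hBA hi) j (hBA hj)

theorem IsDualOn.inner_sum_left {A : Finset ι} {a b : ι → E} (h : IsDualOn A a b) (c : ι → ℝ)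
    {j : ι} (hj : j ∈ A) : ⟪∑ i ∈ A, c i • a i, b j⟫_ℝ = c j := by
  rw [sum_inner, Finset.sum_eq_single_of_mem j hj]
  · simp [inner_smul_left, h j hj j hj]
  · intro i hi hij
    simp [inner_smul_left, h i hi j hj, hij]

theorem IsDualOn.inner_sum_right {A : Finset ι} {a b : ι → E} (h : IsDualOn A a b) (c : ι → ℝ)
    {j : ι} (hj : j ∈ A) : ⟪a j, ∑ i ∈ A, c i • b i⟫_ℝ = c j := by
  rw [inner_sum, Finset.sum_eq_single_of_mem j hj]
  · simp [inner_smul_right, h j hj j hj]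
  · intro i hi hij
    simp [inner_smul_right, h j hj i hi, hij.symm]

theorem exists_isDualOn [FiniteDimensional ℝ E] {A : Finset ι} {a : ι → E}
    (h : LinearIndependent ℝ (fun i : A => a i)) : ∃ b : ι → E, IsDualOn A a b := by
  let B := Module.Basis.span h
  have hex : ∀ j : A, ∃ v : E, ∀ i : A, ⟪a i, v⟫_ℝ = if i = j then 1 else 0 := by
    intro j
    obtain ⟨g, hg⟩ := (B.coord j).exists_extend
    refine ⟨(InnerProductSpace.toDual ℝ E).symm (LinearMap.toContinuousLinearMap g), fun i => ?_⟩
    rw [real_inner_comm, InnerProductSpace.toDual_symm_apply]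
    have h1 : g (B i : E) = B.coord j (B i) := by rw [← hg]; rfl
    have h2 : ((B i : Submodule.span ℝ (Set.range fun i : A => a i)) : E) = a i :=
      congrArg Subtype.val (Module.Basis.span_apply h i)
    rw [h2] at h1
    simp only [LinearMap.coe_toContinuousLinearMap', h1, Module.Basis.coord_apply,
      Module.Basis.repr_self, Finsupp.single_apply]
  choose v hv using hex
  refine ⟨fun j => if hj : j ∈ A then v ⟨j, hj⟩ else 0, fun i hi j hj => ?_⟩
  simp only [hj, dif_pos]
  rw [hv ⟨j, hj⟩ ⟨i, hi⟩]
  simp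

/-- Constraints with linearly independent gradients become affine in suitable local coordinates
that are tangent to the identity: the coordinate map `x ↦ x - x̄ + ∑ (gᵢ(x) - gᵢ(x̄) -
⟨aᵢ, x - x̄⟩) bᵢ` has the identity as strict derivative at `x̄`, and `Θ` is its local inverse. -/
theorem exists_straightening [CompleteSpace E] {A : Finset ι} {a b : ι → E} (hab : IsDualOn A a b)
    {g : ι → E → ℝ} {x₀ : E} (hg : ∀ i ∈ A, HasStrictFDerivAt (g i) (innerSL ℝ (a i)) x₀) :
    ∃ Θ : E → E, Θ 0 = x₀ ∧ HasStrictFDerivAt Θ (ContinuousLinearMap.id ℝ E) 0 ∧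
      ∀ᶠ v in 𝓝 (0 : E), ∀ i ∈ A, g i (Θ v) = g i x₀ + ⟪a i, v⟫_ℝ := by
  let Ψ : E → E := fun x => (x - x₀) + ∑ i ∈ A, (g i x - g i x₀ - innerSL ℝ (a i) (x - x₀)) • b i
  have hΨ0 : Ψ x₀ = 0 := by simp [Ψ]
  have hΨ : HasStrictFDerivAt Ψ
      ((ContinuousLinearEquiv.refl ℝ E : E ≃L[ℝ] E) : E →L[ℝ] E) x₀ := by
    have h1 : ∀ i ∈ A, HasStrictFDerivAt
        (fun x => (g i x - g i x₀ - innerSL ℝ (a i) (x - x₀)) • b i)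
        ((innerSL ℝ (a i) - innerSL ℝ (a i)).smulRight (b i)) x₀ := by
      intro i hi
      have h2 := ((hg i hi).sub_const (g i x₀)).sub
        ((innerSL ℝ (a i)).hasStrictFDerivAt.comp x₀ ((hasStrictFDerivAt_id x₀).sub_const x₀))
      exact h2.smul_const (b i)
    have h3 := ((hasStrictFDerivAt_id (𝕜 := ℝ) x₀).sub_const x₀).add (HasStrictFDerivAt.fun_sum h1)
    refine h3.congr_fderiv ?_
    ext v
    simp
  have hinner : ∀ x, ∀ i ∈ A, ⟪a i, Ψ x⟫_ℝ = g i x - g i x₀ := by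
    intro x i hi
    simp only [Ψ]
    rw [inner_add_right, hab.inner_sum_right _ hi]
    simp
  refine ⟨hΨ.localInverse Ψ _ x₀, ?_, ?_, ?_⟩
  · have := hΨ.localInverse_apply_image
    rwa [hΨ0] at this
  · have := hΨ.to_localInverse
    rw [hΨ0] at this
    exact this
  · have := hΨ.eventually_right_inverse
    rw [hΨ0] at this
    filter_upwards [this] with v hv i hi
    have := hinner (hΨ.localInverse Ψ _ x₀ v) i hi
    rw [hv] at this
    linarith

/-- In straightened coordinates, every direction of the linearized feasible cone is tangent to a
curve along which the constraints hold and vary linearly. -/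
theorem exists_feasible_curve [CompleteSpace E] {A : Finset ι} {a b : ι → E}
    (hab : IsDualOn A a b) {g : ι → E → ℝ} {x₀ : E}
    (hg : ∀ i ∈ A, HasStrictFDerivAt (g i) (innerSL ℝ (a i)) x₀) (w : E) :
    ∃ ξ : ℝ → E, ξ 0 = x₀ ∧ HasDerivAt ξ w 0 ∧
      ∀ᶠ t in 𝓝 (0 : ℝ), ∀ i ∈ A, g i (ξ t) = g i x₀ + t * ⟪a i, w⟫_ℝ := by
  obtain ⟨Θ, h0, hd, he⟩ := exists_straightening hab hg
  have hline : HasDerivAt (fun t : ℝ => t • w) w 0 := by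
    simpa using (hasDerivAt_id (0 : ℝ)).smul_const w
  have htend : Tendsto (fun t : ℝ => t • w) (𝓝 0) (𝓝 0) := by
    simpa using hline.continuousAt.tendsto
  refine ⟨fun t => Θ (t • w), by simp [h0], ?_, ?_⟩
  · have hd' : HasFDerivAt Θ (ContinuousLinearMap.id ℝ E) ((fun t : ℝ => t • w) 0) := by
      simpa using hd.hasFDerivAt
    have h := hd'.comp_hasDerivAt (0 : ℝ) hline
    rwa [ContinuousLinearMap.id_apply] at h
  · filter_upwards [htend.eventually he] with t ht i hi
    rw [ht i hi, inner_smul_right]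

/-- The Karush-Kuhn-Tucker conditions under linear independence. The multiplier of the `i`-th
constraint is read off from the dual vector `b i`; its sign comes from moving along a feasible curve
with direction `-b i`. -/
theorem exists_multiplier_of_isDualOn [CompleteSpace E] {A : Finset ι} {a b : ι → E}
    (hab : IsDualOn A a b) {J : Set ι} {g : ι → E → ℝ} {x₀ : E}
    (hg : ∀ i ∈ A, HasStrictFDerivAt (g i) (innerSL ℝ (a i)) x₀) (hg0 : ∀ i ∈ A, g i x₀ = 0)
    {f : E → ℝ} {u : E} (hf : HasFDerivAt f (innerSL ℝ u) x₀)
    (hmin : ∀ᶠ x in 𝓝 x₀, (∀ i ∈ A, g i x ≤ 0 ∧ (i ∈ J → g i x = 0)) → f x₀ ≤ f x) :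
    ∃ μ : ι → ℝ, u + ∑ i ∈ A, μ i • a i = 0 ∧ ∀ i ∈ A, i ∉ J → 0 ≤ μ i := by
  have hdir : ∀ w, (∀ i ∈ A, ⟪a i, w⟫_ℝ ≤ 0 ∧ (i ∈ J → ⟪a i, w⟫_ℝ = 0)) → 0 ≤ ⟪u, w⟫_ℝ := by
    intro w hw
    obtain ⟨ξ, h0, hd, he⟩ := exists_feasible_curve hab hg w
    have hd' : HasDerivAt (fun t => f (ξ t)) ⟪u, w⟫_ℝ 0 := by
      have hf' : HasFDerivAt f (innerSL ℝ u) (ξ 0) := by rwa [h0]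
      have h := hf'.comp_hasDerivAt (0 : ℝ) hd
      rwa [innerSL_apply_apply] at h
    have htend : Tendsto ξ (𝓝 0) (𝓝 x₀) := by
      have := hd.continuousAt.tendsto
      rwa [h0] at this
    have hev : ∀ᶠ t in 𝓝[>] (0 : ℝ), 0 ≤ t⁻¹ * (f (ξ t) - f x₀) := by
      filter_upwards [nhdsWithin_le_nhds (htend.eventually hmin), nhdsWithin_le_nhds he,
        self_mem_nhdsWithin] with t h1 h2 ht
      have ht : 0 < t := ht
      refine mul_nonneg (inv_nonneg.2 ht.le) (sub_nonneg.2 (h1 fun i hi => ?_))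
      rw [h2 i hi, hg0 i hi, zero_add]
      exact ⟨mul_nonpos_of_nonneg_of_nonpos ht.le (hw i hi).1, fun hJ => by
        rw [(hw i hi).2 hJ, mul_zero]⟩
    have hlim := hd'.tendsto_slope_zero_right
    simp only [zero_add, h0, smul_eq_mul] at hlim
    exact ge_of_tendsto hlim hev
  have hzero : ∀ w, (∀ i ∈ A, ⟪a i, w⟫_ℝ = 0) → ⟪u, w⟫_ℝ = 0 := by
    intro w hw
    refine le_antisymm ?_ (hdir w fun i hi => ⟨(hw i hi).le, fun _ => hw i hi⟩)
    have := hdir (-w) fun i hi => by simp [hw i hi]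
    simpa using this
  refine ⟨fun i => -⟪u, b i⟫_ℝ, ?_, fun i hi hJ => ?_⟩
  · refine ext_inner_right ℝ fun w => ?_
    have h1 := hzero (w - ∑ i ∈ A, ⟪a i, w⟫_ℝ • b i) fun i hi => by
      rw [inner_sub_right, hab.inner_sum_right _ hi, sub_self]
    rw [inner_sub_right, inner_sum] at h1
    rw [inner_add_left, sum_inner, inner_zero_left]
    simp only [inner_smul_right, inner_smul_left, RCLike.conj_to_real] at h1 ⊢
    rw [← h1, sub_eq_add_neg, ← Finset.sum_neg_distrib]
    congr 1
    exact Finset.sum_congr rfl fun i _ => by ring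
  · have := hdir (-b i) fun j hj => by
      rw [inner_neg_right, hab j hj i hi]
      by_cases h : j = i
      · subst h; simp [hJ]
      · simp [h]
    simpa using this

/-- The multiplier increment `ν` is controlled by the residual `η` and the primal increment `d`. -/
theorem exists_multiplier_bound {A : Finset ι} {a b : ι → E} (hab : IsDualOn A a b)
    (H : E →L[ℝ] E) :
    ∃ ε > 0, ∃ B ≥ 0, ∀ (d η R : E) (ν : ι → ℝ), η = H d + ∑ i ∈ A, ν i • a i + R →
      ‖R‖ ≤ ε * (‖d‖ + ∑ i ∈ A, |ν i|) → ∑ i ∈ A, |ν i| ≤ B * (‖η‖ + ‖d‖) := by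
  set B₀ : ℝ := ∑ i ∈ A, ‖b i‖ with hB₀
  have hB₀' : 0 ≤ B₀ := Finset.sum_nonneg fun _ _ => norm_nonneg _
  refine ⟨1 / (2 * (B₀ + 1)), by positivity, 2 * B₀ * (‖H‖ + 1), by positivity, ?_⟩
  intro d η R ν hη hR
  set ε : ℝ := 1 / (2 * (B₀ + 1)) with hε
  have hε1 : ε * B₀ ≤ 1 / 2 := by
    rw [hε, div_mul_eq_mul_div, div_le_div_iff₀ (by positivity) (by positivity)]
    linarith
  have hε2 : ε ≤ 1 := by
    rw [hε, div_le_one (by positivity)]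
    linarith
  have hε0 : 0 < ε := by positivity
  set N : ℝ := ∑ i ∈ A, |ν i| with hN
  have hN0 : 0 ≤ N := Finset.sum_nonneg fun _ _ => abs_nonneg _
  have hsum : ‖∑ i ∈ A, ν i • a i‖ ≤ ‖η‖ + ‖H‖ * ‖d‖ + ‖R‖ := by
    have : ∑ i ∈ A, ν i • a i = η - H d - R := by rw [hη]; abel
    rw [this]
    calc ‖η - H d - R‖ ≤ ‖η‖ + ‖H d‖ + ‖R‖ := by
          refine (norm_sub_le _ _).trans ?_
          gcongr
          exact norm_sub_le _ _
      _ ≤ _ := by gcongr; exact H.le_opNorm d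
  have hN1 : N ≤ B₀ * ‖∑ i ∈ A, ν i • a i‖ := by
    rw [hN, hB₀, Finset.sum_mul]
    refine Finset.sum_le_sum fun i hi => ?_
    rw [← hab.inner_sum_left ν hi, mul_comm]
    exact abs_real_inner_le_norm _ _
  have hd := norm_nonneg d
  have h1 : N ≤ B₀ * (‖η‖ + ‖H‖ * ‖d‖ + ε * (‖d‖ + N)) :=
    hN1.trans (mul_le_mul_of_nonneg_left (hsum.trans (by linarith)) hB₀')
  have h2 : ε * B₀ * N ≤ 1 / 2 * N := mul_le_mul_of_nonneg_right hε1 hN0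
  have h3 : B₀ * (ε * ‖d‖) ≤ B₀ * ‖d‖ :=
    mul_le_mul_of_nonneg_left (by nlinarith) hB₀'
  have h4 : 0 ≤ B₀ * ‖H‖ * ‖η‖ := by positivity
  nlinarith

/-- Stability of the perturbed second-order system. If `H` is positive definite on the subspace
orthogonal to the `a j`, `j ∈ J`, then increments `d`, `ν` of primal and dual variables which satisfy
the linearized complementarity conditions up to a small relative error are bounded by the residual.
-/
theorem exists_stability_estimate {A J : Finset ι} (hJA : J ⊆ A) {a b : ι → E}
    (hab : IsDualOn A a b) (H : E →L[ℝ] E) {c : ℝ} (hc : 0 < c)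
    (hH : ∀ w, (∀ i ∈ J, ⟪a i, w⟫_ℝ = 0) → c * ‖w‖ ^ 2 ≤ ⟪H w, w⟫_ℝ) :
    ∃ ε > 0, ∃ K ≥ 0, ∀ (d η R : E) (ν : ι → ℝ), η = H d + ∑ i ∈ A, ν i • a i + R →
      ‖R‖ ≤ ε * (‖d‖ + ∑ i ∈ A, |ν i|) →
      (∀ i ∈ A, -(ε * (|ν i| * ‖d‖)) ≤ ν i * ⟪a i, d⟫_ℝ) →
      (∀ i ∈ J, |⟪a i, d⟫_ℝ| ≤ ε * ‖d‖) →
      ‖d‖ ≤ K * ‖η‖ ∧ ∑ i ∈ A, |ν i| ≤ K * ‖η‖ := by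
  obtain ⟨ε₁, hε₁, B, hB, hbound⟩ := exists_multiplier_bound hab H
  set B₀ : ℝ := ∑ i ∈ J, ‖b i‖ with hB₀
  have hB₀' : 0 ≤ B₀ := Finset.sum_nonneg fun _ _ => norm_nonneg _
  set h : ℝ := ‖H‖ with hh
  have hh0 : 0 ≤ h := norm_nonneg _
  set T : ℝ := 3 * h * B₀ + 1 + 2 * B with hT
  have hT0 : 0 < T := by positivity
  set ε : ℝ := min (min ε₁ 1) (min (1 / (2 * (B₀ + 1))) (c / (8 * T))) with hε
  have hε0 : 0 < ε := by
    refine lt_min (lt_min hε₁ one_pos) (lt_min ?_ ?_) <;> positivity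
  have hεa : ε ≤ ε₁ := (min_le_left _ _).trans (min_le_left _ _)
  have hεb : ε ≤ 1 := (min_le_left _ _).trans (min_le_right _ _)
  have hεc : ε * B₀ ≤ 1 / 2 := by
    have : ε ≤ 1 / (2 * (B₀ + 1)) := (min_le_right _ _).trans (min_le_left _ _)
    rw [le_div_iff₀ (by positivity)] at this
    linarith
  have hεd : ε * T ≤ c / 8 := by
    have : ε ≤ c / (8 * T) := (min_le_right _ _).trans (min_le_right _ _)
    rw [le_div_iff₀ (by positivity)] at this
    linarith
  set K₁ : ℝ := 8 * (1 + 2 * B) / c with hK₁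
  have hK₁0 : 0 ≤ K₁ := by positivity
  refine ⟨ε, hε0, max K₁ (B * (1 + K₁)), le_max_of_le_left hK₁0, ?_⟩
  intro d η R ν hη hR hcomp hJ
  have hd := norm_nonneg d
  set N : ℝ := ∑ i ∈ A, |ν i| with hN
  have hN0 : 0 ≤ N := Finset.sum_nonneg fun _ _ => abs_nonneg _
  have hNb : N ≤ B * (‖η‖ + ‖d‖) := by
    refine hbound d η R ν hη (hR.trans ?_)
    gcongr
  -- Split `d` into a part `w` orthogonal to the `a j`, `j ∈ J`, and a small remainder `e`.
  set e : E := ∑ i ∈ J, ⟪a i, d⟫_ℝ • b i with he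
  set w : E := d - e with hw
  have hwJ : ∀ i ∈ J, ⟪a i, w⟫_ℝ = 0 := fun i hi => by
    rw [hw, inner_sub_right, he, (hab.mono hJA).inner_sum_right _ hi, sub_self]
  have hen : ‖e‖ ≤ ε * B₀ * ‖d‖ := by
    calc ‖e‖ ≤ ∑ i ∈ J, ε * ‖d‖ * ‖b i‖ := by
          refine norm_sum_le_of_le _ fun i hi => ?_
          rw [norm_smul, Real.norm_eq_abs]
          gcongr
          exact hJ i hi
      _ = ε * B₀ * ‖d‖ := by rw [← Finset.mul_sum]; ring
  have hw1 : ‖d‖ / 2 ≤ ‖w‖ := by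
    have h1 : ‖d‖ ≤ ‖w‖ + ‖e‖ := by
      calc ‖d‖ = ‖w + e‖ := by rw [hw, sub_add_cancel]
        _ ≤ _ := norm_add_le _ _
    nlinarith
  have hw2 : ‖w‖ ≤ 2 * ‖d‖ := by
    have h1 : ‖w‖ ≤ ‖d‖ + ‖e‖ := norm_sub_le _ _
    nlinarith
  have hquad : (c / 4 - 3 * h * (ε * B₀)) * ‖d‖ ^ 2 ≤ ⟪H d, d⟫_ℝ := by
    have h1 : ⟪H d, d⟫_ℝ = ⟪H w, w⟫_ℝ + ⟪H w, e⟫_ℝ + ⟪H e, d⟫_ℝ := by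
      have hdw : d = w + e := by rw [hw, sub_add_cancel]
      have : ⟪H d, d⟫_ℝ = ⟪H w, d⟫_ℝ + ⟪H e, d⟫_ℝ := by
        rw [← inner_add_left, ← map_add, ← hdw]
      rw [this]
      congr 1
      rw [← inner_add_right, ← hdw]
    have h2 : -(h * (2 * ‖d‖) * (ε * B₀ * ‖d‖)) ≤ ⟪H w, e⟫_ℝ := by
      refine (abs_le.1 ((abs_real_inner_le_norm _ _).trans ?_)).1
      have : ‖H w‖ ≤ h * (2 * ‖d‖) := (H.le_opNorm w).trans (by gcongr)
      gcongr
    have h3 : -(h * (ε * B₀ * ‖d‖) * ‖d‖) ≤ ⟪H e, d⟫_ℝ := by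
      refine (abs_le.1 ((abs_real_inner_le_norm _ _).trans ?_)).1
      have : ‖H e‖ ≤ h * (ε * B₀ * ‖d‖) := (H.le_opNorm e).trans (by gcongr)
      gcongr
    have h4 : c * (‖d‖ / 2) ^ 2 ≤ c * ‖w‖ ^ 2 := by gcongr
    have h5 := hH w hwJ
    nlinarith
  have hinner : ⟪η, d⟫_ℝ = ⟪H d, d⟫_ℝ + ∑ i ∈ A, ν i * ⟪a i, d⟫_ℝ + ⟪R, d⟫_ℝ := by
    rw [hη, inner_add_left, inner_add_left, sum_inner]
    simp [inner_smul_left]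
  have hsum : -(ε * (N * ‖d‖)) ≤ ∑ i ∈ A, ν i * ⟪a i, d⟫_ℝ := by
    rw [hN, Finset.sum_mul, Finset.mul_sum, ← Finset.sum_neg_distrib]
    exact Finset.sum_le_sum hcomp
  have hRd : -(ε * (‖d‖ + N) * ‖d‖) ≤ ⟪R, d⟫_ℝ := by
    refine (abs_le.1 ((abs_real_inner_le_norm _ _).trans ?_)).1
    gcongr
  have hηd : ⟪η, d⟫_ℝ ≤ ‖η‖ * ‖d‖ := real_inner_le_norm _ _
  have hNd : ε * (N * ‖d‖) ≤ ε * (B * (‖η‖ + ‖d‖) * ‖d‖) := by gcongr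
  have hmain : c / 8 * ‖d‖ ^ 2 ≤ (1 + 2 * B) * ‖η‖ * ‖d‖ := by
    have h1 : ε * T * ‖d‖ ^ 2 ≤ c / 8 * ‖d‖ ^ 2 := by gcongr
    have h2 : 2 * (ε * (B * ‖η‖ * ‖d‖)) ≤ 2 * (B * ‖η‖ * ‖d‖) := by
      have : 0 ≤ B * ‖η‖ * ‖d‖ := by positivity
      nlinarith
    rw [hT] at h1
    nlinarith
  have hdK : ‖d‖ ≤ K₁ * ‖η‖ := by
    rcases hd.eq_or_lt with h0 | h0
    · rw [← h0]; positivity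
    · rw [hK₁, div_mul_eq_mul_div, le_div_iff₀ hc]
      have : c / 8 * ‖d‖ ≤ (1 + 2 * B) * ‖η‖ := by
        refine le_of_mul_le_mul_right ?_ h0
        linarith
      linarith
  have hη0 := norm_nonneg η
  refine ⟨hdK.trans (by gcongr; exact le_max_left _ _), ?_⟩
  calc N ≤ B * (‖η‖ + K₁ * ‖η‖) := hNb.trans (by gcongr)
    _ = B * (1 + K₁) * ‖η‖ := by ring
    _ ≤ _ := by gcongr; exact le_max_right _ _

end DualFamily

/-! ### Tilted quadratics over convex sets and critical cones -/

section TiltedQuadratic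

variable {E : Type*} [NormedAddCommGroup E] [InnerProductSpace ℝ E]

/-- The quadratic function `d ↦ ½⟨Hd, d⟩ - ⟨p, d⟩`. -/
noncomputable def tiltedQuadratic (H : E →L[ℝ] E) (p d : E) : ℝ :=
  1 / 2 * ⟪H d, d⟫_ℝ - ⟪p, d⟫_ℝ

theorem tiltedQuadratic_sub {H : E →L[ℝ] E} (hH : ∀ u v, ⟪H u, v⟫_ℝ = ⟪u, H v⟫_ℝ) (p d d' : E) :
    tiltedQuadratic H p d' - tiltedQuadratic H p d =
      ⟪H d - p, d' - d⟫_ℝ + 1 / 2 * ⟪H (d' - d), d' - d⟫_ℝ := by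
  have h : ⟪H d', d⟫_ℝ = ⟪H d, d'⟫_ℝ := by rw [hH, real_inner_comm]
  simp only [tiltedQuadratic, map_sub, inner_sub_left, inner_sub_right]
  linarith

theorem continuous_tiltedQuadratic (H : E →L[ℝ] E) (p : E) :
    Continuous (tiltedQuadratic H p) := by
  unfold tiltedQuadratic
  fun_prop

theorem exists_tiltedQuadratic_min [FiniteDimensional ℝ E] {K : Set E} (hK : IsClosed K)
    {d₀ : E} (hd₀ : d₀ ∈ K) {H : E →L[ℝ] E} {c : ℝ} (hc : 0 < c)
    (hH : ∀ d ∈ K, c * ‖d‖ ^ 2 ≤ ⟪H d, d⟫_ℝ) (p : E) :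
    ∃ d ∈ K, ∀ d' ∈ K, tiltedQuadratic H p d ≤ tiltedQuadratic H p d' := by
  set q₀ := tiltedQuadratic H p d₀
  have hlarge : ∀ᶠ d in cocompact E ⊓ 𝓟 K, q₀ ≤ tiltedQuadratic H p d := by
    rw [eventually_inf_principal]
    filter_upwards [(tendsto_norm_cocompact_atTop (E := E)).eventually_ge_atTop
      (2 / c * (‖p‖ + |q₀|) + 1)] with d hd hdK
    have h1 := hH d hdK
    have h2 : ⟪p, d⟫_ℝ ≤ ‖p‖ * ‖d‖ := real_inner_le_norm _ _
    have h3 : (‖p‖ + |q₀|) ≤ c / 2 * ‖d‖ := by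
      have : c / 2 * (2 / c * (‖p‖ + |q₀|)) ≤ c / 2 * ‖d‖ := by gcongr; linarith
      rwa [← mul_assoc, div_mul_div_cancel₀ two_ne_zero, div_self hc.ne', one_mul] at this
    have h4 : 1 ≤ ‖d‖ := by
      have : 0 ≤ 2 / c * (‖p‖ + |q₀|) := by positivity
      linarith
    have h5 : (‖p‖ + |q₀|) * ‖d‖ ≤ c / 2 * ‖d‖ * ‖d‖ := by gcongr
    have h6 : |q₀| * 1 ≤ |q₀| * ‖d‖ := by gcongr
    have h7 := le_abs_self q₀
    unfold tiltedQuadratic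
    nlinarith
  obtain ⟨d, hd, hmin⟩ :=
    (continuous_tiltedQuadratic H p).continuousOn.exists_isMinOn' hK hd₀ hlarge
  exact ⟨d, hd, fun d' hd' => hmin hd'⟩

theorem inner_nonneg_of_tiltedQuadratic_min {K : Set E} (hK : Convex ℝ K) {H : E →L[ℝ] E}
    (hH : ∀ u v, ⟪H u, v⟫_ℝ = ⟪u, H v⟫_ℝ) {p d : E} (hd : d ∈ K)
    (hmin : ∀ d' ∈ K, tiltedQuadratic H p d ≤ tiltedQuadratic H p d') {d' : E} (hd' : d' ∈ K) :
    0 ≤ ⟪H d - p, d' - d⟫_ℝ := by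
  have hlim : Tendsto (fun t : ℝ => ⟪H d - p, d' - d⟫_ℝ + t * (1 / 2 * ⟪H (d' - d), d' - d⟫_ℝ))
      (𝓝[>] 0) (𝓝 ⟪H d - p, d' - d⟫_ℝ) := by
    have : Continuous
        (fun t : ℝ => ⟪H d - p, d' - d⟫_ℝ + t * (1 / 2 * ⟪H (d' - d), d' - d⟫_ℝ)) := by fun_prop
    have h := (this.tendsto 0).mono_left (nhdsWithin_le_nhds (s := Set.Ioi 0))
    simpa using h
  refine ge_of_tendsto hlim ?_
  filter_upwards [Ioo_mem_nhdsGT (zero_lt_one (α := ℝ))] with t ht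
  have hmem : d + t • (d' - d) ∈ K := hK.add_smul_sub_mem hd hd' ⟨ht.1.le, ht.2.le⟩
  have h1 := tiltedQuadratic_sub hH p d (d + t • (d' - d))
  have h2 := hmin _ hmem
  simp only [add_sub_cancel_left, map_smul, inner_smul_left, inner_smul_right,
    RCLike.conj_to_real] at h1
  have h3 : 0 ≤ t * (⟪H d - p, d' - d⟫_ℝ + t * (1 / 2 * ⟪H (d' - d), d' - d⟫_ℝ)) := by
    linarith
  exact nonneg_of_mul_nonneg_right h3 ht.1

/-- The minimizers of tilted functions form a monotone set. -/
theorem inner_nonneg_of_two_tiltedQuadratic_min {K : Set E} {H : E →L[ℝ] E} {p p' d d' : E}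
    (hd : d ∈ K) (hmin : ∀ x ∈ K, tiltedQuadratic H p d ≤ tiltedQuadratic H p x)
    (hd' : d' ∈ K) (hmin' : ∀ x ∈ K, tiltedQuadratic H p' d' ≤ tiltedQuadratic H p' x) :
    0 ≤ ⟪d' - d, p' - p⟫_ℝ := by
  have h1 := hmin d' hd'
  have h2 := hmin' d hd
  simp only [tiltedQuadratic] at h1 h2
  rw [real_inner_comm]
  simp only [inner_sub_left, inner_sub_right]
  linarith

/-- A continuous selection of minimizers exhausts the minimizers. -/
theorem tiltedQuadratic_min_unique {K : Set E} {H : E →L[ℝ] E} {D : E → E}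
    (hD : Continuous D) (hDK : ∀ p, D p ∈ K)
    (hDmin : ∀ p, ∀ x ∈ K, tiltedQuadratic H p (D p) ≤ tiltedQuadratic H p x) {p d : E}
    (hd : d ∈ K) (hmin : ∀ x ∈ K, tiltedQuadratic H p d ≤ tiltedQuadratic H p x) : d = D p := by
  -- Monotonicity against the tilts `p + t v` gives `0 ≤ ⟨D p - d, v⟩` for every `v` as `t ↓ 0`.
  have key : ∀ v, 0 ≤ ⟪D p - d, v⟫_ℝ := by
    intro v
    have hlim : Tendsto (fun t : ℝ => ⟪D (p + t • v) - d, v⟫_ℝ) (𝓝[>] 0) (𝓝 ⟪D p - d, v⟫_ℝ) := by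
      have : Continuous (fun t : ℝ => ⟪D (p + t • v) - d, v⟫_ℝ) := by fun_prop
      have h := (this.tendsto 0).mono_left (nhdsWithin_le_nhds (s := Set.Ioi 0))
      simpa using h
    refine ge_of_tendsto hlim ?_
    filter_upwards [self_mem_nhdsWithin] with t ht
    have h := inner_nonneg_of_two_tiltedQuadratic_min hd hmin (hDK (p + t • v)) (hDmin _)
    rw [add_sub_cancel_left, inner_smul_right] at h
    exact nonneg_of_mul_nonneg_right h ht
  have h := key (-(D p - d))
  rw [inner_neg_right, real_inner_self_eq_norm_sq] at h
  have : ‖D p - d‖ = 0 := by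
    have := sq_nonneg ‖D p - d‖
    exact pow_eq_zero_iff two_ne_zero |>.1 (by linarith)
  exact (sub_eq_zero.1 (norm_eq_zero.1 this)).symm

/-- The identity plus a monotone Lipschitz mapping is surjective: the solution of `p + T p = u` is
the fixed point of a damped iteration. -/
theorem exists_add_eq_of_monotone_lipschitz [CompleteSpace E] {T : E → E} {κ : ℝ≥0}
    (hT : LipschitzWith κ T) (hmono : ∀ p p', 0 ≤ ⟪T p - T p', p - p'⟫_ℝ) (u : E) :
    ∃ p, p + T p = u := by
  set M : ℝ := (κ : ℝ) ^ 2 with hM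
  have hM0 : 0 ≤ M := sq_nonneg _
  set α : ℝ := 1 / (1 + M) with hα
  have hα0 : 0 < α := by positivity
  have hα1 : α ≤ 1 := by rw [hα, div_le_one (by positivity)]; linarith
  have hαM : α * (1 + M) = 1 := by rw [hα]; field_simp
  let F : E → E := fun p => p - α • (p + T p - u)
  obtain ⟨q, hq⟩ : ∃ q : ℝ≥0, (q : ℝ) = 1 - α / 2 := ⟨⟨1 - α / 2, by linarith⟩, rfl⟩
  have hF : ContractingWith q F := by
    refine ⟨?_, LipschitzWith.of_dist_le_mul fun p p' => ?_⟩
    · rw [← NNReal.coe_lt_coe, hq, NNReal.coe_one]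
      linarith
    · have hT' := hT.dist_le_mul p p'
      rw [dist_eq_norm, dist_eq_norm] at hT' ⊢
      refine le_of_sq_le_sq ?_ (by positivity)
      rw [hq]
      have h1 : F p - F p' = (1 - α) • (p - p') - α • (T p - T p') := by
        simp only [F]; module
      rw [h1, norm_sub_sq_real, norm_smul, norm_smul, Real.norm_eq_abs, Real.norm_eq_abs,
        inner_smul_left, inner_smul_right, mul_pow, mul_pow, sq_abs, sq_abs]
      have h2 := hmono p p'
      rw [real_inner_comm] at h2
      have h3 : ‖T p - T p'‖ ^ 2 ≤ M * ‖p - p'‖ ^ 2 := by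
        rw [hM, ← mul_pow]; gcongr
      have h4 : 0 ≤ (1 - α) * (α * ⟪p - p', T p - T p'⟫_ℝ) :=
        mul_nonneg (by linarith) (mul_nonneg hα0.le h2)
      have h5 : α ^ 2 * ‖T p - T p'‖ ^ 2 ≤ α ^ 2 * (M * ‖p - p'‖ ^ 2) := by gcongr
      have h6 : ((1 - α) ^ 2 + α ^ 2 * M) * ‖p - p'‖ ^ 2 ≤ (1 - α / 2) ^ 2 * ‖p - p'‖ ^ 2 := by
        gcongr
        have : α ^ 2 * (1 + M) = α := by rw [pow_two, mul_assoc, hαM, mul_one]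
        nlinarith
      simp only [RCLike.conj_to_real, mul_pow]
      linarith
  refine ⟨hF.fixedPoint F, ?_⟩
  have h := hF.fixedPoint_isFixedPt
  have h' : α • (hF.fixedPoint F + T (hF.fixedPoint F) - u) = 0 := by
    have : hF.fixedPoint F - α • (hF.fixedPoint F + T (hF.fixedPoint F) - u) = hF.fixedPoint F := h
    exact sub_eq_self.1 this
  exact sub_eq_zero.1 ((smul_eq_zero.1 h').resolve_left hα0.ne')

/-- If the minimizers of the tilted quadratics over a convex set depend in a Lipschitz continuous way
on the tilt, then each point `d` of the set is the minimizer for the tilt `H d`. -/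
theorem lipschitz_argmin_apply_self [CompleteSpace E] {K : Set E} (hK : Convex ℝ K)
    {H : E →L[ℝ] E} (hH : ∀ u v, ⟪H u, v⟫_ℝ = ⟪u, H v⟫_ℝ) {D : E → E} {κ : ℝ≥0}
    (hD : LipschitzWith κ D) (hDK : ∀ p, D p ∈ K)
    (hDmin : ∀ p, ∀ x ∈ K, tiltedQuadratic H p (D p) ≤ tiltedQuadratic H p x) {d : E}
    (hd : d ∈ K) : D (H d) = d := by
  obtain ⟨r, hr⟩ : ∃ r : ℝ, r = ‖H‖ + 1 := ⟨_, rfl⟩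
  have hr0 : 0 ≤ r := by rw [hr]; positivity
  -- For `p + r D p = H d + r d` both `d` and `D p` solve a strongly monotone inequality.
  obtain ⟨p, hp⟩ : ∃ p, p + r • D p = H d + r • d := by
    refine exists_add_eq_of_monotone_lipschitz (T := fun p => r • D p)
      ((lipschitzWith_smul r).comp hD) (fun p p' => ?_) _
    have := inner_nonneg_of_two_tiltedQuadratic_min (hDK p') (hDmin p') (hDK p) (hDmin p)
    rw [← smul_sub, inner_smul_left]
    exact mul_nonneg hr0 this
  have h1 := inner_nonneg_of_tiltedQuadratic_min hK hH (hDK p) (hDmin p) hd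
  have hp' : p = H d + r • d - r • D p := eq_sub_of_add_eq hp
  have h2 : H (D p) - p = -(H (d - D p) + r • (d - D p)) := by
    generalize D p = x at hp' ⊢
    rw [hp', map_sub]
    module
  rw [h2, inner_neg_left, inner_add_left, inner_smul_left, real_inner_self_eq_norm_sq] at h1
  simp only [RCLike.conj_to_real] at h1
  have h3 : -(‖H‖ * ‖d - D p‖ * ‖d - D p‖) ≤ ⟪H (d - D p), d - D p⟫_ℝ := by
    refine (abs_le.1 ((abs_real_inner_le_norm _ _).trans ?_)).1
    gcongr
    exact H.le_opNorm _
  have h4 : ‖d - D p‖ = 0 := by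
    have : ‖d - D p‖ ^ 2 ≤ 0 := by rw [hr] at h1; nlinarith
    exact pow_eq_zero_iff two_ne_zero |>.1 (le_antisymm this (sq_nonneg _))
  have h5 : d = D p := sub_eq_zero.1 (norm_eq_zero.1 h4)
  have h6 : p = H d := by
    rw [← h5] at hp'
    simpa using hp'
  rw [← h6, ← h5]

theorem inner_pos_of_argmin_apply_self {K : Set E} {H : E →L[ℝ] E}
    (hH : ∀ u v, ⟪H u, v⟫_ℝ = ⟪u, H v⟫_ℝ)
    (hmin : ∀ d ∈ K, ∀ x ∈ K, tiltedQuadratic H (H d) d ≤ tiltedQuadratic H (H d) x)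
    (huniq : ∀ d ∈ K, ∀ d' ∈ K,
      (∀ x ∈ K, tiltedQuadratic H (H d) d' ≤ tiltedQuadratic H (H d) x) → d' = d)
    {d d' : E} (hd : d ∈ K) (hd' : d' ∈ K) (hne : d' ≠ d) : 0 < ⟪H (d' - d), d' - d⟫_ℝ := by
  have h1 := tiltedQuadratic_sub hH (H d) d d'
  rw [sub_self, inner_zero_left, zero_add] at h1
  have h2 := hmin d hd d' hd'
  rcases (show 0 ≤ ⟪H (d' - d), d' - d⟫_ℝ by linarith).eq_or_lt with h | h
  · exact absurd (huniq d hd d' hd' fun x hx => by linarith [hmin d hd x hx]) hne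
  · exact h

end TiltedQuadratic

section CriticalCone

variable {E : Type*} [NormedAddCommGroup E] [InnerProductSpace ℝ E]
variable {ι : Type*}

/-- The critical cone determined by constraint gradients `a i`: the directions along which the
constraints in `J` are stationary and those in `A` do not increase. -/
def criticalCone (A J : Finset ι) (a : ι → E) : Set E :=
  {w | ∀ i ∈ A, ⟪a i, w⟫_ℝ ≤ 0 ∧ (i ∈ J → ⟪a i, w⟫_ℝ = 0)}

theorem isClosed_criticalCone (A J : Finset ι) (a : ι → E) : IsClosed (criticalCone A J a) := by
  have : criticalCone A J a = ⋂ i ∈ A, ({w | ⟪a i, w⟫_ℝ ≤ 0} ∩ {w | i ∈ J → ⟪a i, w⟫_ℝ = 0}) := by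
    ext w; simp [criticalCone]
  rw [this]
  refine isClosed_biInter fun i _ => IsClosed.inter ?_ ?_
  · exact isClosed_le (by fun_prop) continuous_const
  · by_cases hi : i ∈ J
    · simpa [hi] using isClosed_eq (f := fun w => ⟪a i, w⟫_ℝ) (by fun_prop) continuous_const
    · simp [hi]

theorem convex_criticalCone (A J : Finset ι) (a : ι → E) : Convex ℝ (criticalCone A J a) := by
  intro x hx y hy s t hs ht _ i hi
  simp only [inner_add_right, inner_smul_right]
  refine ⟨?_, fun hJ => by rw [(hx i hi).2 hJ, (hy i hi).2 hJ]; simp⟩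
  have h1 := mul_nonpos_of_nonneg_of_nonpos hs (hx i hi).1
  have h2 := mul_nonpos_of_nonneg_of_nonpos ht (hy i hi).1
  linarith

theorem zero_mem_criticalCone (A J : Finset ι) (a : ι → E) : (0 : E) ∈ criticalCone A J a :=
  fun i _ => by simp

/-- Under linear independence, the critical cone spans its subspace of directions orthogonal to the
`a j`, `j ∈ J`, as a difference set. -/
theorem exists_sub_mem_criticalCone [DecidableEq ι] {A J : Finset ι} {a b : ι → E}
    (hab : IsDualOn A a b) {w : E} (hw : ∀ i ∈ J, ⟪a i, w⟫_ℝ = 0) :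
    ∃ d ∈ criticalCone A J a, d + w ∈ criticalCone A J a := by
  set c : ι → ℝ := fun i => if i ∈ J then 0 else -|⟪a i, w⟫_ℝ|
  refine ⟨∑ i ∈ A, c i • b i, fun i hi => ?_, fun i hi => ?_⟩
  · rw [hab.inner_sum_right _ hi]
    by_cases h : i ∈ J <;> simp [c, h]
  · rw [inner_add_right, hab.inner_sum_right _ hi]
    by_cases h : i ∈ J
    · simp [c, h, hw i h]
    · simp [c, h, le_abs_self]

theorem exists_quadratic_lower_bound [FiniteDimensional ℝ E] {J : Finset ι} {a : ι → E}
    {H : E →L[ℝ] E} (hH : ∀ w, (∀ i ∈ J, ⟪a i, w⟫_ℝ = 0) → w ≠ 0 → 0 < ⟪H w, w⟫_ℝ) :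
    ∃ c > 0, ∀ w, (∀ i ∈ J, ⟪a i, w⟫_ℝ = 0) → c * ‖w‖ ^ 2 ≤ ⟪H w, w⟫_ℝ := by
  set S : Set E := {w | (∀ i ∈ J, ⟪a i, w⟫_ℝ = 0)} ∩ Metric.sphere 0 1 with hS
  have hcomp : IsCompact S := by
    refine (isCompact_sphere 0 1).inter_left ?_
    have : {w : E | ∀ i ∈ J, ⟪a i, w⟫_ℝ = 0} = ⋂ i ∈ J, {w | ⟪a i, w⟫_ℝ = 0} := by ext; simp
    rw [this]
    exact isClosed_biInter fun i _ => isClosed_eq (by fun_prop) continuous_const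
  have hcont : ContinuousOn (fun w => ⟪H w, w⟫_ℝ) S := by fun_prop
  have hscale : ∀ w, w ≠ 0 → (∀ i ∈ J, ⟪a i, w⟫_ℝ = 0) → ‖w‖⁻¹ • w ∈ S := by
    intro w hw0 hw
    refine ⟨fun i hi => by rw [inner_smul_right, hw i hi, mul_zero], ?_⟩
    simp [norm_smul, hw0]
  rcases S.eq_empty_or_nonempty with hemp | hne
  · refine ⟨1, one_pos, fun w hw => ?_⟩
    by_cases hw0 : w = 0
    · simp [hw0]
    · have := hscale w hw0 hw
      simp [hemp] at this
  · obtain ⟨v, hv, hvmin⟩ := hcomp.exists_isMinOn hne hcont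
    refine ⟨⟪H v, v⟫_ℝ, hH v hv.1 ?_, fun w hw => ?_⟩
    · rintro rfl
      simpa using hv.2
    · by_cases hw0 : w = 0
      · simp [hw0]
      · have h : ⟪H v, v⟫_ℝ ≤ ⟪H (‖w‖⁻¹ • w), ‖w‖⁻¹ • w⟫_ℝ := hvmin (hscale w hw0 hw)
        simp only [map_smul, inner_smul_left, inner_smul_right, RCLike.conj_to_real] at h
        have hpos : 0 < ‖w‖ := norm_pos_iff.2 hw0
        calc ⟪H v, v⟫_ℝ * ‖w‖ ^ 2 ≤ (‖w‖⁻¹ * (‖w‖⁻¹ * ⟪H w, w⟫_ℝ)) * ‖w‖ ^ 2 := by gcongr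
          _ = ⟪H w, w⟫_ℝ := by field_simp

end CriticalCone

/-! ### Second-order expansions -/

section SecondOrder

variable {E : Type*} [NormedAddCommGroup E] [InnerProductSpace ℝ E]

theorem inner_map_symm_of_hasFDerivAt_gradient {l : E → ℝ} {G : E → E} {H : E →L[ℝ] E} {x₀ : E}
    (hl : ∀ᶠ x in 𝓝 x₀, HasFDerivAt l (innerSL ℝ (G x)) x) (hG : HasFDerivAt G H x₀) (u v : E) :
    ⟪H u, v⟫_ℝ = ⟪u, H v⟫_ℝ := by
  let B : E →L[ℝ] E →L[ℝ] ℝ := innerSL ℝ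
  have h := second_derivative_symmetric_of_eventually_of_real
    (f' := fun x => innerSL ℝ (G x)) (f'' := B.comp H) hl (B.hasFDerivAt.comp x₀ hG) u v
  have h' : ⟪H u, v⟫_ℝ = ⟪H v, u⟫_ℝ := h
  rw [h', real_inner_comm]

/-- Second-order expansion at a stationary point of a function whose gradient is differentiable
there. -/
theorem isLittleO_second_order {l : E → ℝ} {G : E → E} {H : E →L[ℝ] E} {x₀ : E}
    (hl : ∀ᶠ x in 𝓝 x₀, HasFDerivAt l (innerSL ℝ (G x)) x) (hG : HasFDerivAt G H x₀)
    (hG0 : G x₀ = 0) :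
    (fun x => l x - l x₀ - 1 / 2 * ⟪H (x - x₀), x - x₀⟫_ℝ) =o[𝓝 x₀] fun x => ‖x - x₀‖ ^ 2 := by
  have hsymm := inner_map_symm_of_hasFDerivAt_gradient hl hG
  rw [isLittleO_iff]
  intro ε hε
  have hG' := (hasFDerivAt_iff_isLittleO.1 hG).def hε
  obtain ⟨δ, hδ, hball⟩ := Metric.eventually_nhds_iff_ball.1 (hl.and hG')
  filter_upwards [Metric.ball_mem_nhds x₀ hδ] with x hx
  set r := ‖x - x₀‖ with hr
  have hrδ : r < δ := by rwa [hr, ← dist_eq_norm]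
  have hsub : Metric.closedBall x₀ r ⊆ Metric.ball x₀ δ := Metric.closedBall_subset_ball hrδ
  have hderiv : ∀ z ∈ Metric.closedBall x₀ r,
      HasFDerivWithinAt (fun z => l z - 1 / 2 * ⟪H (z - x₀), z - x₀⟫_ℝ)
        (innerSL ℝ (G z - H (z - x₀))) (Metric.closedBall x₀ r) z := by
    intro z hz
    have h1 := (hball z (hsub hz)).1
    have h2 : HasFDerivAt (fun z => z - x₀) (ContinuousLinearMap.id ℝ E) z :=
      (hasFDerivAt_id z).sub_const x₀
    have h3 := (H.hasFDerivAt.comp z h2).inner ℝ h2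
    have h4 := h1.sub (h3.const_mul (1 / 2))
    refine (h4.congr_fderiv ?_).hasFDerivWithinAt
    ext v
    have : ⟪H v, z - x₀⟫_ℝ = ⟪H (z - x₀), v⟫_ℝ := by rw [hsymm, real_inner_comm]
    simp [fderivInnerCLM_apply, this, inner_sub_left]
    ring
  have hbound : ∀ z ∈ Metric.closedBall x₀ r, ‖innerSL ℝ (G z - H (z - x₀))‖ ≤ ε * r := by
    intro z hz
    have h1 := (hball z (hsub hz)).2
    rw [hG0, sub_zero] at h1
    rw [innerSL_apply_norm]
    refine h1.trans ?_
    rw [Metric.mem_closedBall, dist_eq_norm] at hz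
    gcongr
  have hmv := Convex.norm_image_sub_le_of_norm_hasFDerivWithin_le hderiv hbound
    (convex_closedBall x₀ r) (Metric.mem_closedBall_self (norm_nonneg _))
    (show x ∈ Metric.closedBall x₀ r by rw [Metric.mem_closedBall, dist_eq_norm])
  simp only [sub_self, map_zero, inner_zero_left, mul_zero, sub_zero] at hmv
  rw [show l x - l x₀ - 1 / 2 * ⟪H (x - x₀), x - x₀⟫_ℝ =
    l x - 1 / 2 * ⟪H (x - x₀), x - x₀⟫_ℝ - l x₀ by ring]
  refine hmv.trans (le_of_eq ?_)
  rw [Real.norm_eq_abs, abs_of_nonneg (by positivity)]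
  ring

theorem tendsto_sub_of_slope {F : Filter ℝ} (hF : F ≤ 𝓝[>] 0) {ξ : ℝ → E} {x₀ w : E}
    (hξ : Tendsto (fun t => t⁻¹ • (ξ t - x₀)) F (𝓝 w)) : Tendsto (fun t => ξ t - x₀) F (𝓝 0) := by
  have h1 : Tendsto (fun t : ℝ => t) F (𝓝 0) := (tendsto_id.mono_left hF).mono_right
    nhdsWithin_le_nhds
  have h2 := h1.smul hξ
  rw [zero_smul] at h2
  refine h2.congr' ?_
  filter_upwards [hF self_mem_nhdsWithin] with t ht
  rw [smul_inv_smul₀ (ne_of_gt ht)]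

theorem tendsto_first_order {F : Filter ℝ} (hF : F ≤ 𝓝[>] 0) {ξ : ℝ → E} {x₀ w : E}
    (hξ : Tendsto (fun t => t⁻¹ • (ξ t - x₀)) F (𝓝 w)) {f : E → ℝ} {u : E}
    (hf : HasFDerivAt f (innerSL ℝ u) x₀) :
    Tendsto (fun t => t⁻¹ * (f (ξ t) - f x₀)) F (𝓝 ⟪u, w⟫_ℝ) := by
  have h := (hasFDerivWithinAt_univ.2 hf).lim (tendsto_sub_of_slope hF hξ)
    (Eventually.of_forall fun _ => Set.mem_univ _) hξ
  simpa using h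

theorem tendsto_second_order {F : Filter ℝ} (hF : F ≤ 𝓝[>] 0) {ξ : ℝ → E} {x₀ w : E}
    (hξ : Tendsto (fun t => t⁻¹ • (ξ t - x₀)) F (𝓝 w)) {l : E → ℝ} {G : E → E} {H : E →L[ℝ] E}
    (hl : ∀ᶠ x in 𝓝 x₀, HasFDerivAt l (innerSL ℝ (G x)) x) (hG : HasFDerivAt G H x₀)
    (hG0 : G x₀ = 0) :
    Tendsto (fun t => (l (ξ t) - l x₀) / t ^ 2) F (𝓝 (1 / 2 * ⟪H w, w⟫_ℝ)) := by
  have hξ0 : Tendsto ξ F (𝓝 x₀) := by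
    simpa using (tendsto_sub_of_slope hF hξ).add_const x₀
  have hpos : ∀ᶠ t in F, 0 < t := hF self_mem_nhdsWithin
  have hO : (fun t => ‖ξ t - x₀‖ ^ 2) =O[F] fun t => t ^ 2 := by
    have h1 : (fun t => t⁻¹ • (ξ t - x₀)) =O[F] fun _ => (1 : ℝ) := hξ.isBigO_one ℝ
    have h2 : (fun t => ξ t - x₀) =O[F] fun t => t := by
      have h3 := (isBigO_refl (fun t : ℝ => t) F).smul h1
      simp only [smul_eq_mul, mul_one] at h3
      refine h3.congr' ?_ EventuallyEq.rfl
      filter_upwards [hpos] with t ht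
      rw [smul_inv_smul₀ (ne_of_gt ht)]
    exact h2.norm_left.pow 2
  have hrem := (((isLittleO_second_order hl hG hG0).comp_tendsto hξ0).trans_isBigO
    hO).tendsto_div_nhds_zero
  have hquad : Tendsto (fun t => 1 / 2 * ⟪H (t⁻¹ • (ξ t - x₀)), t⁻¹ • (ξ t - x₀)⟫_ℝ) F
      (𝓝 (1 / 2 * ⟪H w, w⟫_ℝ)) :=
    (((H.continuous.tendsto w).comp hξ).inner hξ).const_mul _
  have hsum := hrem.add hquad
  rw [zero_add] at hsum
  refine hsum.congr' ?_
  filter_upwards [hpos] with t ht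
  simp only [Function.comp_apply, map_smul, inner_smul_left, inner_smul_right,
    RCLike.conj_to_real]
  field_simp
  ring

end SecondOrder

/-! ### The nonlinear program near a regular Karush-Kuhn-Tucker point -/

section Gradients

variable {n : ℕ} {f : EuclideanSpace ℝ (Fin n) → ℝ} {x₀ : EuclideanSpace ℝ (Fin n)}

theorem innerSL_gradient (f : EuclideanSpace ℝ (Fin n) → ℝ) (x : EuclideanSpace ℝ (Fin n)) :
    innerSL ℝ (gradient f x) = fderiv ℝ f x := by
  ext v
  simp [inner_gradient_left]

theorem SmoothWithStrictGradient.eventually_hasStrictFDerivAt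
    (hf : SmoothWithStrictGradient f x₀) :
    ∀ᶠ x in 𝓝 x₀, HasStrictFDerivAt f (innerSL ℝ (gradient f x)) x := by
  filter_upwards [hf.1.eventually (by simp)] with x hx
  rw [innerSL_gradient]
  exact hx.hasStrictFDerivAt one_ne_zero

theorem SmoothWithStrictGradient.hasStrictFDerivAt (hf : SmoothWithStrictGradient f x₀) :
    HasStrictFDerivAt f (innerSL ℝ (gradient f x₀)) x₀ :=
  hf.eventually_hasStrictFDerivAt.self_of_nhds

theorem SmoothWithStrictGradient.continuousAt_gradient (hf : SmoothWithStrictGradient f x₀) :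
    ContinuousAt (gradient f) x₀ :=
  hf.2.choose_spec.continuousAt

theorem SmoothWithStrictGradient.continuousAt (hf : SmoothWithStrictGradient f x₀) :
    ContinuousAt f x₀ :=
  hf.hasStrictFDerivAt.continuousAt

theorem gradient_eq_of_hasFDerivAt {u : EuclideanSpace ℝ (Fin n)}
    (h : HasFDerivAt f (innerSL ℝ u) x₀) : gradient f x₀ = u := by
  refine ext_inner_right ℝ fun v => ?_
  rw [inner_gradient_left, h.fderiv]
  rfl

end Gradients

section RegularKKT

variable {n m : ℕ}

open Classical in
/-- The indices of the constraints active at `x`. -/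
noncomputable def activeSet (φ : Fin m → EuclideanSpace ℝ (Fin n) → ℝ)
    (x : EuclideanSpace ℝ (Fin n)) : Finset (Fin m) :=
  Finset.univ.filter fun i => φ i x = 0

open Classical in
/-- The indices of the strongly active constraints: the equality constraints and the active
inequality constraints with positive multiplier. -/
noncomputable def strictlyActiveSet (s : ℕ) (φ : Fin m → EuclideanSpace ℝ (Fin n) → ℝ)
    (x : EuclideanSpace ℝ (Fin n)) (μ : EuclideanSpace ℝ (Fin m)) : Finset (Fin m) :=
  Finset.univ.filter fun i => φ i x = 0 ∧ (s ≤ (i : ℕ) ∨ 0 < μ i)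

/-- The critical cone of the nonlinear program at `x` for the multiplier `μ`. -/
noncomputable abbrev criticalDirections (s : ℕ) (φ : Fin m → EuclideanSpace ℝ (Fin n) → ℝ)
    (x : EuclideanSpace ℝ (Fin n)) (μ : EuclideanSpace ℝ (Fin m)) :
    Set (EuclideanSpace ℝ (Fin n)) :=
  criticalCone (activeSet φ x) (strictlyActiveSet s φ x μ) fun i => gradient (φ i) x

/-- The standing situation: `x̄` is feasible with multiplier `μ̄`, the data are smooth there, the
active gradients have the dual family `b` (so they are linearly independent), and `H` is the Hessian
at `x̄` of the Lagrangian `L(·, μ̄)`. -/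
structure IsRegularKKT (s : ℕ) (φ₀ : EuclideanSpace ℝ (Fin n) → ℝ)
    (φ : Fin m → EuclideanSpace ℝ (Fin n) → ℝ) (xbar : EuclideanSpace ℝ (Fin n))
    (μbar : EuclideanSpace ℝ (Fin m)) (b : Fin m → EuclideanSpace ℝ (Fin n))
    (H : EuclideanSpace ℝ (Fin n) →L[ℝ] EuclideanSpace ℝ (Fin n)) : Prop where
  feasible : xbar ∈ feasibleSet s φ
  smooth₀ : SmoothWithStrictGradient φ₀ xbar
  smooth : ∀ i, SmoothWithStrictGradient (φ i) xbar
  multiplier : IsMultiplier s φ₀ φ xbar μbar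
  dual : IsDualOn (activeSet φ xbar) (fun i => gradient (φ i) xbar) b
  hessian : HasStrictFDerivAt (fun x => gradient φ₀ x + ∑ i, μbar i • gradient (φ i) x) H xbar

variable {s : ℕ} {φ₀ : EuclideanSpace ℝ (Fin n) → ℝ}
  {φ : Fin m → EuclideanSpace ℝ (Fin n) → ℝ} {xbar : EuclideanSpace ℝ (Fin n)}
  {μbar : EuclideanSpace ℝ (Fin m)} {b : Fin m → EuclideanSpace ℝ (Fin n)}
  {H : EuclideanSpace ℝ (Fin n) →L[ℝ] EuclideanSpace ℝ (Fin n)}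

theorem mem_activeSet {x : EuclideanSpace ℝ (Fin n)} {i : Fin m} :
    i ∈ activeSet φ x ↔ φ i x = 0 := by
  simp [activeSet]

theorem mem_strictlyActiveSet {x : EuclideanSpace ℝ (Fin n)} {μ : EuclideanSpace ℝ (Fin m)}
    {i : Fin m} : i ∈ strictlyActiveSet s φ x μ ↔ φ i x = 0 ∧ (s ≤ (i : ℕ) ∨ 0 < μ i) := by
  simp [strictlyActiveSet]

theorem strictlyActiveSet_subset (x : EuclideanSpace ℝ (Fin n)) (μ : EuclideanSpace ℝ (Fin m)) :
    strictlyActiveSet s φ x μ ⊆ activeSet φ x := fun _ hi =>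
  mem_activeSet.2 (mem_strictlyActiveSet.1 hi).1

theorem nonpos_of_mem_feasibleSet {x : EuclideanSpace ℝ (Fin n)} (hx : x ∈ feasibleSet s φ)
    (i : Fin m) : φ i x ≤ 0 := by
  rcases lt_or_ge (i : ℕ) s with h | h
  · exact (hx i).1 h
  · exact ((hx i).2 h).le

theorem lt_of_not_mem_activeSet {x : EuclideanSpace ℝ (Fin n)} (hx : x ∈ feasibleSet s φ)
    {i : Fin m} (hi : i ∉ activeSet φ x) : (i : ℕ) < s := by
  by_contra h
  exact hi (mem_activeSet.2 ((hx i).2 (not_lt.1 h)))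

theorem IsMultiplier.eq_zero {x : EuclideanSpace ℝ (Fin n)} (hx : x ∈ feasibleSet s φ)
    {μ : EuclideanSpace ℝ (Fin m)} (hμ : IsMultiplier s φ₀ φ x μ) {i : Fin m}
    (hi : i ∉ activeSet φ x) : μ i = 0 :=
  (mul_eq_zero.1 (hμ.2 i (lt_of_not_mem_activeSet hx hi)).2).resolve_right
    fun h => hi (mem_activeSet.2 h)

theorem IsMultiplier.mul_eq_zero {x : EuclideanSpace ℝ (Fin n)} (hx : x ∈ feasibleSet s φ)
    {μ : EuclideanSpace ℝ (Fin m)} (hμ : IsMultiplier s φ₀ φ x μ) (i : Fin m) :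
    μ i * φ i x = 0 := by
  rcases lt_or_ge (i : ℕ) s with h | h
  · exact (hμ.2 i h).2
  · rw [(hx i).2 h, mul_zero]

namespace IsRegularKKT

theorem eventually_hasFDerivAt_lagrangian (hR : IsRegularKKT s φ₀ φ xbar μbar b H)
    : ∀ᶠ x in 𝓝 xbar, ∀ μ : EuclideanSpace ℝ (Fin m),
    HasFDerivAt (fun x => lagrangian φ₀ φ x μ)
      (innerSL ℝ (gradient φ₀ x + ∑ i, μ i • gradient (φ i) x)) x := by
  filter_upwards [hR.smooth₀.eventually_hasStrictFDerivAt,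
    eventually_all.2 fun i => (hR.smooth i).eventually_hasStrictFDerivAt] with x h0 hi μ
  have h := h0.hasFDerivAt.add (HasFDerivAt.fun_sum (u := Finset.univ)
    fun i _ => (hi i).hasFDerivAt.const_mul (μ i))
  refine h.congr_fderiv ?_
  ext v
  simp

theorem inner_comm_hessian (hR : IsRegularKKT s φ₀ φ xbar μbar b H)
    (u v : EuclideanSpace ℝ (Fin n)) : ⟪H u, v⟫_ℝ = ⟪u, H v⟫_ℝ := by
  refine inner_map_symm_of_hasFDerivAt_gradient (l := fun x => lagrangian φ₀ φ x μbar) ?_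
    hR.hessian.hasFDerivAt u v
  exact hR.eventually_hasFDerivAt_lagrangian.mono fun x hx => hx μbar

theorem lagrangian_self (hR : IsRegularKKT s φ₀ φ xbar μbar b H)
    : lagrangian φ₀ φ xbar μbar = φ₀ xbar := by
  simp [lagrangian, hR.multiplier.mul_eq_zero hR.feasible]

theorem mul_nonpos_of_mem (hR : IsRegularKKT s φ₀ φ xbar μbar b H)
    {x : EuclideanSpace ℝ (Fin n)} (hx : x ∈ feasibleSet s φ) (i : Fin m) :
    μbar i * φ i x ≤ 0 := by
  rcases lt_or_ge (i : ℕ) s with h | h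
  · exact mul_nonpos_of_nonneg_of_nonpos (hR.multiplier.2 i h).1 ((hx i).1 h)
  · rw [(hx i).2 h, mul_zero]

theorem lagrangian_le (hR : IsRegularKKT s φ₀ φ xbar μbar b H)
    {x : EuclideanSpace ℝ (Fin n)} (hx : x ∈ feasibleSet s φ) :
    lagrangian φ₀ φ x μbar ≤ φ₀ x := by
  have := Finset.sum_nonpos fun i (_ : i ∈ Finset.univ) => hR.mul_nonpos_of_mem hx i
  unfold lagrangian
  linarith

theorem eventually_inactive_neg (hR : IsRegularKKT s φ₀ φ xbar μbar b H)
    :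
    ∀ᶠ x in 𝓝 xbar, ∀ i, i ∉ activeSet φ xbar → φ i x < 0 := by
  refine eventually_all.2 fun i => ?_
  by_cases hi : i ∈ activeSet φ xbar
  · simp [hi]
  · have h : φ i xbar < 0 := lt_of_le_of_ne (nonpos_of_mem_feasibleSet hR.feasible i)
      fun h => hi (mem_activeSet.2 h)
    filter_upwards [(hR.smooth i).continuousAt.eventually_lt_const h] with x hx _
    exact hx

/-- Every critical direction is tangent to a feasible curve along which the objective agrees with
the Lagrangian. -/
theorem exists_curve (hR : IsRegularKKT s φ₀ φ xbar μbar b H)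
    {w : EuclideanSpace ℝ (Fin n)}
    (hw : w ∈ criticalDirections s φ xbar μbar) :
    ∃ ξ : ℝ → EuclideanSpace ℝ (Fin n),
      Tendsto (fun t => t⁻¹ • (ξ t - xbar)) (𝓝[>] 0) (𝓝 w) ∧
      ∀ᶠ t in 𝓝[>] (0 : ℝ), ξ t ∈ feasibleSet s φ ∧ φ₀ (ξ t) = lagrangian φ₀ φ (ξ t) μbar := by
  obtain ⟨ξ, h0, hd, he⟩ :=
    exists_feasible_curve hR.dual (fun i _ => (hR.smooth i).hasStrictFDerivAt) w
  refine ⟨ξ, by simpa [h0] using hd.tendsto_slope_zero_right, ?_⟩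
  have hξ : Tendsto ξ (𝓝 0) (𝓝 xbar) := by
    have := hd.continuousAt.tendsto
    rwa [h0] at this
  filter_upwards [nhdsWithin_le_nhds he, self_mem_nhdsWithin,
    nhdsWithin_le_nhds (hξ.eventually hR.eventually_inactive_neg)] with t ht htpos hneg
  have htpos : 0 < t := htpos
  have hactive : ∀ i ∈ activeSet φ xbar, φ i (ξ t) = t * ⟪gradient (φ i) xbar, w⟫_ℝ := by
    intro i hi
    rw [ht i hi, mem_activeSet.1 hi, zero_add]
  have hstrict : ∀ i ∈ strictlyActiveSet s φ xbar μbar, φ i (ξ t) = 0 := by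
    intro i hi
    have hiA := strictlyActiveSet_subset _ _ hi
    rw [hactive i hiA, (hw i hiA).2 hi, mul_zero]
  refine ⟨fun i => ⟨fun _ => ?_, fun hi => ?_⟩, ?_⟩
  · by_cases hiA : i ∈ activeSet φ xbar
    · rw [hactive i hiA]
      exact mul_nonpos_of_nonneg_of_nonpos htpos.le (hw i hiA).1
    · exact (hneg i hiA).le
  · exact hstrict i (mem_strictlyActiveSet.2 ⟨(hR.feasible i).2 hi, Or.inl hi⟩)
  · unfold lagrangian
    rw [Finset.sum_eq_zero, add_zero]
    intro i _
    by_cases hiA : i ∈ activeSet φ xbar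
    · by_cases hiJ : i ∈ strictlyActiveSet s φ xbar μbar
      · rw [hstrict i hiJ, mul_zero]
      · have h1 : ¬(s ≤ (i : ℕ) ∨ 0 < μbar i) := fun h =>
          hiJ (mem_strictlyActiveSet.2 ⟨mem_activeSet.1 hiA, h⟩)
        push Not at h1
        rw [le_antisymm h1.2 (hR.multiplier.2 i h1.1).1, zero_mul]
    · rw [hR.multiplier.eq_zero hR.feasible hiA, zero_mul]

theorem tendsto_lagrangian (hR : IsRegularKKT s φ₀ φ xbar μbar b H)
    {F : Filter ℝ} (hF : F ≤ 𝓝[>] 0) {ξ : ℝ → EuclideanSpace ℝ (Fin n)}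
    {w : EuclideanSpace ℝ (Fin n)} (hξ : Tendsto (fun t => t⁻¹ • (ξ t - xbar)) F (𝓝 w)) :
    Tendsto (fun t => (lagrangian φ₀ φ (ξ t) μbar - φ₀ xbar) / t ^ 2) F
      (𝓝 (1 / 2 * ⟪H w, w⟫_ℝ)) := by
  rw [← hR.lagrangian_self]
  exact tendsto_second_order hF hξ (l := fun x => lagrangian φ₀ φ x μbar)
    (hR.eventually_hasFDerivAt_lagrangian.mono fun x hx => hx μbar) hR.hessian.hasFDerivAt
    hR.multiplier.1

/-- Second-order necessary condition at a local minimizer. -/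
theorem inner_hessian_nonneg (hR : IsRegularKKT s φ₀ φ xbar μbar b H)
    (hmin : IsLocalMinOn φ₀ (feasibleSet s φ) xbar)
    {w : EuclideanSpace ℝ (Fin n)}
    (hw : w ∈ criticalDirections s φ xbar μbar) : 0 ≤ ⟪H w, w⟫_ℝ := by
  obtain ⟨ξ, hξ, hfeas⟩ := hR.exists_curve hw
  have hξ0 : Tendsto ξ (𝓝[>] 0) (𝓝 xbar) := by
    simpa using (tendsto_sub_of_slope le_rfl hξ).add_const xbar
  have hlim := hR.tendsto_lagrangian le_rfl hξ
  have hmin' : ∀ᶠ x in 𝓝 xbar, x ∈ feasibleSet s φ → φ₀ xbar ≤ φ₀ x :=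
    eventually_nhdsWithin_iff.1 hmin
  have : 0 ≤ 1 / 2 * ⟪H w, w⟫_ℝ := by
    refine ge_of_tendsto hlim ?_
    filter_upwards [hfeas, hξ0.eventually hmin'] with t h1 h2
    rw [← h1.2]
    exact div_nonneg (sub_nonneg.2 (h2 h1.1)) (sq_nonneg t)
  linarith

/-- If each critical direction `d` is the unique minimizer over the critical cone of the quadratic
with tilt `H d`, then the Hessian is positive definite on the span of the critical cone. -/
theorem inner_hessian_pos_of_argmin (hR : IsRegularKKT s φ₀ φ xbar μbar b H)
    (hmin : ∀ d ∈ criticalDirections s φ xbar μbar, ∀ x ∈ criticalDirections s φ xbar μbar,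
      tiltedQuadratic H (H d) d ≤ tiltedQuadratic H (H d) x)
    (huniq : ∀ d ∈ criticalDirections s φ xbar μbar, ∀ d' ∈ criticalDirections s φ xbar μbar,
      (∀ x ∈ criticalDirections s φ xbar μbar,
        tiltedQuadratic H (H d) d' ≤ tiltedQuadratic H (H d) x) → d' = d)
    (w : EuclideanSpace ℝ (Fin n))
    (hw : ∀ i ∈ strictlyActiveSet s φ xbar μbar, ⟪gradient (φ i) xbar, w⟫_ℝ = 0) (hw0 : w ≠ 0) :
    0 < ⟪H w, w⟫_ℝ := by
  obtain ⟨d, hd, hdw⟩ := exists_sub_mem_criticalCone hR.dual hw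
  have := inner_pos_of_argmin_apply_self hR.inner_comm_hessian hmin huniq hd hdw
    (by simpa using hw0)
  simpa using this

end IsRegularKKT
end RegularKKT

/-! ### Tilt stability implies the strong second-order condition -/

section TiltToSecondOrder

variable {n m : ℕ} {s : ℕ} {φ₀ : EuclideanSpace ℝ (Fin n) → ℝ}
  {φ : Fin m → EuclideanSpace ℝ (Fin n) → ℝ} {xbar : EuclideanSpace ℝ (Fin n)}
  {μbar : EuclideanSpace ℝ (Fin m)} {b : Fin m → EuclideanSpace ℝ (Fin n)}
  {H : EuclideanSpace ℝ (Fin n) →L[ℝ] EuclideanSpace ℝ (Fin n)}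

theorem mem_tiltArgmin_extendedObjective (hfeas : xbar ∈ feasibleSet s φ) {γ : ℝ} (hγ : 0 ≤ γ)
    {x y : EuclideanSpace ℝ (Fin n)} :
    x ∈ tiltArgmin (extendedObjective s φ₀ φ) xbar γ y ↔
      ‖x - xbar‖ ≤ γ ∧ x ∈ feasibleSet s φ ∧ ∀ x' ∈ feasibleSet s φ, ‖x' - xbar‖ ≤ γ →
        φ₀ x - ⟪y, x - xbar⟫_ℝ ≤ φ₀ x' - ⟪y, x' - xbar⟫_ℝ := by
  have hval : ∀ z ∈ feasibleSet s φ, extendedObjective s φ₀ φ z - extendedObjective s φ₀ φ xbar -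
      ((⟪y, z - xbar⟫_ℝ : ℝ) : EReal) = ((φ₀ z - φ₀ xbar - ⟪y, z - xbar⟫_ℝ : ℝ) : EReal) := by
    intro z hz
    simp [extendedObjective, hz, hfeas]
  have htop : ∀ z, z ∉ feasibleSet s φ →
      extendedObjective s φ₀ φ z - extendedObjective s φ₀ φ xbar -
      ((⟪y, z - xbar⟫_ℝ : ℝ) : EReal) = ⊤ := by
    intro z hz
    simp [extendedObjective, hz, hfeas]
  constructor
  · rintro ⟨h1, h2⟩
    have hx : x ∈ feasibleSet s φ := by
      by_contra hx
      have := h2 xbar (by simpa using hγ)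
      rw [htop x hx, hval xbar hfeas, top_le_iff] at this
      exact EReal.coe_ne_top _ this
    refine ⟨h1, hx, fun x' hx' hx'γ => ?_⟩
    have := h2 x' hx'γ
    rw [hval x hx, hval x' hx', EReal.coe_le_coe_iff] at this
    linarith
  · rintro ⟨h1, hx, h2⟩
    refine ⟨h1, fun x' hx'γ => ?_⟩
    by_cases hx' : x' ∈ feasibleSet s φ
    · rw [hval x hx, hval x' hx', EReal.coe_le_coe_iff]
      linarith [h2 x' hx' hx'γ]
    · rw [htop x' hx']
      exact le_top

theorem isLocalMinOn_of_isTiltStableLocalMin (hfeas : xbar ∈ feasibleSet s φ)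
    (h : IsTiltStableLocalMin (extendedObjective s φ₀ φ) xbar) :
    IsLocalMinOn φ₀ (feasibleSet s φ) xbar := by
  obtain ⟨-, -, γ, hγ, U, hU, σ, K, -, hσ0, hσ⟩ := h
  have h0 : xbar ∈ tiltArgmin (extendedObjective s φ₀ φ) xbar γ 0 := by
    rw [hσ 0 (mem_of_mem_nhds hU), hσ0]
    rfl
  have h1 := ((mem_tiltArgmin_extendedObjective hfeas hγ.le).1 h0).2.2
  filter_upwards [nhdsWithin_le_nhds (Metric.closedBall_mem_nhds xbar hγ), self_mem_nhdsWithin]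
    with x hx hxX
  rw [Metric.mem_closedBall, dist_eq_norm] at hx
  simpa using h1 x hxX hx

theorem exists_tendsto_of_bounded {E : Type*} [NormedAddCommGroup E] [ProperSpace E] {α : Type*}
    (F : Ultrafilter α) {v : α → E} {R : ℝ} (hv : ∀ᶠ t in F, ‖v t‖ ≤ R) :
    ∃ w, Tendsto v F (𝓝 w) := by
  obtain ⟨w, -, hw⟩ := (isCompact_closedBall (0 : E) R).ultrafilter_le_nhds (F.map v) <| by
    rw [le_principal_iff]
    have : ∀ᶠ t in F, v t ∈ Metric.closedBall (0 : E) R := hv.mono fun t ht => by simpa using ht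
    exact this
  exact ⟨w, hw⟩

/-- Rescaling the tilted minimizers `M(tp)` as `t ↓ 0` gives a Lipschitz continuous selection `D` of
minimizers of the tilted quadratics over the critical cone. The limits are taken along one
ultrafilter, so that they exist for all `p` simultaneously. -/
theorem IsRegularKKT.exists_lipschitz_argmin (hR : IsRegularKKT s φ₀ φ xbar μbar b H)
    (h : IsTiltStableLocalMin (extendedObjective s φ₀ φ) xbar) :
    ∃ (D : EuclideanSpace ℝ (Fin n) → EuclideanSpace ℝ (Fin n)) (κ : ℝ≥0), LipschitzWith κ D ∧
      (∀ p, D p ∈ criticalDirections s φ xbar μbar) ∧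
      ∀ p, ∀ w ∈ criticalDirections s φ xbar μbar,
        tiltedQuadratic H p (D p) ≤ tiltedQuadratic H p w := by
  obtain ⟨-, -, γ, hγ, U, hU, σ, κ, hLip, hσ0, hσ⟩ := h
  have hmem : ∀ y ∈ U, σ y ∈ feasibleSet s φ ∧ ∀ x' ∈ feasibleSet s φ, ‖x' - xbar‖ ≤ γ →
      φ₀ (σ y) - ⟪y, σ y - xbar⟫_ℝ ≤ φ₀ x' - ⟪y, x' - xbar⟫_ℝ := fun y hy =>
    ((mem_tiltArgmin_extendedObjective hR.feasible hγ.le).1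
      (by rw [hσ y hy]; rfl)).2
  let F₀ : Ultrafilter ℝ := Ultrafilter.of (𝓝[>] (0 : ℝ))
  let F : Filter ℝ := F₀
  have : F.NeBot := F₀.neBot
  have hF : F ≤ 𝓝[>] 0 := Ultrafilter.of_le _
  have hpos : ∀ᶠ t in F, 0 < t := hF self_mem_nhdsWithin
  have hUev : ∀ p : EuclideanSpace ℝ (Fin n), ∀ᶠ t in F, t • p ∈ U := by
    intro p
    have : Tendsto (fun t : ℝ => t • p) (𝓝 0) (𝓝 0) := by
      have h : Continuous fun t : ℝ => t • p := by fun_prop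
      simpa using h.tendsto 0
    exact hF (nhdsWithin_le_nhds (this hU))
  have hdist : ∀ p p' : EuclideanSpace ℝ (Fin n), ∀ᶠ t in F,
      ‖t⁻¹ • (σ (t • p) - xbar) - t⁻¹ • (σ (t • p') - xbar)‖ ≤ κ * ‖p - p'‖ := by
    intro p p'
    filter_upwards [hpos, hUev p, hUev p'] with t ht h1 h2
    have h3 := hLip.dist_le_mul _ h1 _ h2
    rw [dist_eq_norm, dist_eq_norm, ← smul_sub, norm_smul, Real.norm_of_nonneg ht.le] at h3
    rw [← smul_sub, sub_sub_sub_cancel_right, norm_smul, norm_inv, Real.norm_of_nonneg ht.le,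
      inv_mul_le_iff₀ ht]
    linarith
  have hlim : ∀ p, ∃ d, Tendsto (fun t => t⁻¹ • (σ (t • p) - xbar)) F (𝓝 d) := by
    intro p
    refine exists_tendsto_of_bounded F₀ (R := κ * ‖p‖) ?_
    filter_upwards [hdist p 0] with t ht
    simpa [hσ0] using ht
  choose D hD using hlim
  refine ⟨D, κ, ?_, ?_, ?_⟩
  · refine LipschitzWith.of_dist_le_mul fun p p' => ?_
    rw [dist_eq_norm, dist_eq_norm]
    exact le_of_tendsto ((hD p).sub (hD p')).norm (hdist p p')
  · intro p
    have hσlim : Tendsto (fun t => σ (t • p) - xbar) F (𝓝 0) := tendsto_sub_of_slope hF (hD p)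
    have hφ : ∀ i, Tendsto (fun t => t⁻¹ * (φ i (σ (t • p)) - φ i xbar)) F
        (𝓝 ⟪gradient (φ i) xbar, D p⟫_ℝ) := fun i =>
      tendsto_first_order hF (hD p) (hR.smooth i).hasStrictFDerivAt.hasFDerivAt
    have hle : ∀ i ∈ activeSet φ xbar, ⟪gradient (φ i) xbar, D p⟫_ℝ ≤ 0 := by
      intro i hi
      refine le_of_tendsto (hφ i) ?_
      filter_upwards [hpos, hUev p] with t ht h1
      rw [mem_activeSet.1 hi, sub_zero]
      exact mul_nonpos_of_nonneg_of_nonpos (inv_nonneg.2 ht.le)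
        (nonpos_of_mem_feasibleSet (hmem _ h1).1 i)
    have heq : ∀ i : Fin m, s ≤ (i : ℕ) → ⟪gradient (φ i) xbar, D p⟫_ℝ = 0 := by
      intro i hi
      refine tendsto_nhds_unique (hφ i) (tendsto_const_nhds.congr' ?_)
      filter_upwards [hUev p] with t h1
      rw [((hmem _ h1).1 i).2 hi, (hR.feasible i).2 hi, sub_zero, mul_zero]
    -- The objective does not increase to first order, which makes all terms
    -- `μ̄ᵢ ⟨∇φᵢ, D p⟩` of the stationarity identity vanish.
    have hobj : ⟪gradient φ₀ xbar, D p⟫_ℝ ≤ 0 := by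
      have h1 := tendsto_first_order hF (hD p) hR.smooth₀.hasStrictFDerivAt.hasFDerivAt
      have h2 : Tendsto (fun t => ⟪p, σ (t • p) - xbar⟫_ℝ) F (𝓝 0) := by
        simpa using (tendsto_const_nhds (x := p)).inner hσlim
      refine le_of_tendsto_of_tendsto h1 h2 ?_
      filter_upwards [hpos, hUev p] with t ht h3
      have h4 := (hmem _ h3).2 xbar hR.feasible (by simpa using hγ.le)
      rw [inner_smul_left, sub_self, inner_zero_right, sub_zero] at h4
      rw [inv_mul_le_iff₀ ht]
      simp only [RCLike.conj_to_real] at h4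
      linarith
    have hterm : ∀ i, μbar i * ⟪gradient (φ i) xbar, D p⟫_ℝ ≤ 0 := by
      intro i
      by_cases hi : i ∈ activeSet φ xbar
      · rcases lt_or_ge (i : ℕ) s with h | h
        · exact mul_nonpos_of_nonneg_of_nonpos (hR.multiplier.2 i h).1 (hle i hi)
        · rw [heq i h, mul_zero]
      · rw [hR.multiplier.eq_zero hR.feasible hi, zero_mul]
    have hsum : 0 ≤ ∑ i, μbar i * ⟪gradient (φ i) xbar, D p⟫_ℝ := by
      have h1 := congrArg (fun v => ⟪v, D p⟫_ℝ) hR.multiplier.1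
      simp only [inner_add_left, sum_inner, inner_smul_left, RCLike.conj_to_real,
        inner_zero_left] at h1
      linarith
    have hzero := (Finset.sum_eq_zero_iff_of_nonpos fun i _ => hterm i).1
      (le_antisymm (Finset.sum_nonpos fun i _ => hterm i) hsum)
    refine fun i hi => ⟨hle i hi, fun hJ => ?_⟩
    rcases (mem_strictlyActiveSet.1 hJ).2 with h | h
    · exact heq i h
    · exact (mul_eq_zero.1 (hzero i (Finset.mem_univ i))).resolve_left h.ne'
  · intro p w hw
    obtain ⟨ξ, hξ, hfeas⟩ := hR.exists_curve hw
    have hξF : Tendsto (fun t => t⁻¹ • (ξ t - xbar)) F (𝓝 w) := hξ.mono_left hF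
    have hsq : ∀ {ζ : ℝ → EuclideanSpace ℝ (Fin n)} {v : EuclideanSpace ℝ (Fin n)},
        Tendsto (fun t => t⁻¹ • (ζ t - xbar)) F (𝓝 v) →
        Tendsto (fun t => (lagrangian φ₀ φ (ζ t) μbar - φ₀ xbar) / t ^ 2 -
          ⟪p, t⁻¹ • (ζ t - xbar)⟫_ℝ) F (𝓝 (tiltedQuadratic H p v)) := fun hζ =>
      (hR.tendsto_lagrangian hF hζ).sub ((tendsto_const_nhds (x := p)).inner hζ)
    refine le_of_tendsto_of_tendsto (hsq (hD p)) (hsq hξF) ?_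
    have hnear : ∀ᶠ t in F, ‖ξ t - xbar‖ ≤ γ := by
      have h := (tendsto_sub_of_slope hF hξF).norm
      rw [norm_zero] at h
      exact (h.eventually_lt_const hγ).mono fun t ht => ht.le
    filter_upwards [hpos, hUev p, hF hfeas, hnear] with t ht h1 h2 h3
    have h4 := (hmem _ h1).2 (ξ t) h2.1 h3
    have h5 := hR.lagrangian_le (hmem _ h1).1
    rw [h2.2] at h4
    simp only [inner_smul_left, inner_smul_right, RCLike.conj_to_real] at h4 ⊢
    have h6 : ∀ A B : ℝ, A / t ^ 2 - t⁻¹ * B = (A - t * B) / t ^ 2 := by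
      intro A B; field_simp
    rw [h6, h6]
    gcongr ?_ / _
    linarith

/-- Tilt stability forces the strong second-order condition. -/
theorem IsRegularKKT.inner_hessian_pos_of_isTiltStableLocalMin
    (hR : IsRegularKKT s φ₀ φ xbar μbar b H)
    (h : IsTiltStableLocalMin (extendedObjective s φ₀ φ) xbar) (w : EuclideanSpace ℝ (Fin n))
    (hw : ∀ i ∈ strictlyActiveSet s φ xbar μbar, ⟪gradient (φ i) xbar, w⟫_ℝ = 0) (hw0 : w ≠ 0) :
    0 < ⟪H w, w⟫_ℝ := by
  obtain ⟨D, κ, hD, hDK, hDmin⟩ := hR.exists_lipschitz_argmin h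
  have hself : ∀ d ∈ criticalDirections s φ xbar μbar, D (H d) = d := fun d hd =>
    lipschitz_argmin_apply_self (convex_criticalCone _ _ _) hR.inner_comm_hessian hD hDK hDmin hd
  refine hR.inner_hessian_pos_of_argmin (fun d hd x hx => ?_) (fun d hd d' hd' hmin => ?_) w hw hw0
  · have := hDmin (H d) x hx
    rwa [hself d hd] at this
  · rw [tiltedQuadratic_min_unique hD.continuous hDK hDmin hd' hmin, hself d hd]

end TiltToSecondOrder

/-! ### The critical system and the normal cone of the variational inequality -/

section CriticalTriple

variable {E : Type*} [NormedAddCommGroup E] [InnerProductSpace ℝ E]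
variable {ι : Type*}

/-- The Karush-Kuhn-Tucker system of the problem of minimizing the quadratic with Hessian `H` and
tilt `p` over the critical cone: `d` is the primal and `ν` the dual solution. -/
structure IsCriticalTriple (A J : Finset ι) (a : ι → E) (H : E →L[ℝ] E) (p d : E)
    (ν : ι → ℝ) : Prop where
  eq : p = H d + ∑ i ∈ A, ν i • a i
  mem : d ∈ criticalCone A J a
  compl : ∀ i ∈ A, i ∉ J → 0 ≤ ν i ∧ ν i * ⟪a i, d⟫_ℝ = 0

variable {A J : Finset ι} {a : ι → E} {H : E →L[ℝ] E}

theorem isCriticalTriple_zero : IsCriticalTriple A J a H 0 0 (fun _ => 0) where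
  eq := by simp
  mem := zero_mem_criticalCone _ _ _
  compl := by simp

theorem IsCriticalTriple.of_mem {d : E} (hd : d ∈ criticalCone A J a) :
    IsCriticalTriple A J a H (H d) d (fun _ => 0) where
  eq := by simp
  mem := hd
  compl := by simp

theorem IsCriticalTriple.smul {p d : E} {ν : ι → ℝ} (h : IsCriticalTriple A J a H p d ν) {t : ℝ}
    (ht : 0 ≤ t) : IsCriticalTriple A J a H (t • p) (t • d) (fun i => t * ν i) where
  eq := by
    rw [h.eq, map_smul, smul_add, Finset.smul_sum]
    simp only [mul_smul]
  mem := fun i hi => by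
    rw [inner_smul_right]
    exact ⟨mul_nonpos_of_nonneg_of_nonpos ht (h.mem i hi).1, fun hJ => by
      rw [(h.mem i hi).2 hJ, mul_zero]⟩
  compl := fun i hi hJ => by
    obtain ⟨h1, h2⟩ := h.compl i hi hJ
    refine ⟨mul_nonneg ht h1, ?_⟩
    rw [inner_smul_right, mul_mul_mul_comm, h2, mul_zero]

theorem exists_isCriticalTriple_of_min [CompleteSpace E] [DecidableEq ι] {b : ι → E}
    (hab : IsDualOn A a b) (hH : ∀ u v, ⟪H u, v⟫_ℝ = ⟪u, H v⟫_ℝ) {p d : E}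
    (hd : d ∈ criticalCone A J a)
    (hmin : ∀ x ∈ criticalCone A J a, tiltedQuadratic H p d ≤ tiltedQuadratic H p x) :
    ∃ ν, IsCriticalTriple A J a H p d ν := by
  classical
  set B : Finset ι := A.filter fun i => ⟪a i, d⟫_ℝ = 0 with hB
  have hBA : B ⊆ A := Finset.filter_subset _ _
  have hderiv : HasFDerivAt (tiltedQuadratic H p) (innerSL ℝ (H d - p)) d := by
    have h1 := (H.hasFDerivAt (x := d)).inner ℝ (hasFDerivAt_id d)
    have h2 := (h1.const_mul (1 / 2)).sub (innerSL ℝ p).hasFDerivAt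
    refine h2.congr_fderiv ?_
    ext v
    have : ⟪H v, d⟫_ℝ = ⟪H d, v⟫_ℝ := by rw [hH, real_inner_comm]
    simp [fderivInnerCLM_apply, this]
    ring
  have hloc : ∀ᶠ x in 𝓝 d, (∀ i ∈ B, ⟪a i, x⟫_ℝ ≤ 0 ∧ (i ∈ (J : Set ι) → ⟪a i, x⟫_ℝ = 0)) →
      tiltedQuadratic H p d ≤ tiltedQuadratic H p x := by
    have h : ∀ᶠ x in 𝓝 d, ∀ i ∈ A \ B, ⟪a i, x⟫_ℝ < 0 := by
      rw [eventually_all_finset]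
      intro i hi
      have hi' := Finset.mem_sdiff.1 hi
      have hneg : ⟪a i, d⟫_ℝ < 0 := lt_of_le_of_ne (hd i hi'.1).1 fun h0 =>
        hi'.2 (Finset.mem_filter.2 ⟨hi'.1, h0⟩)
      have hcont : Continuous fun x => ⟪a i, x⟫_ℝ := by fun_prop
      exact (hcont.tendsto d).eventually_lt_const hneg
    filter_upwards [h] with x hx hxB
    refine hmin x fun i hi => ?_
    by_cases hiB : i ∈ B
    · exact hxB i hiB
    · refine ⟨(hx i (Finset.mem_sdiff.2 ⟨hi, hiB⟩)).le, fun hJ => ?_⟩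
      exact absurd (Finset.mem_filter.2 ⟨hi, (hd i hi).2 hJ⟩) hiB
  obtain ⟨μ, hμ, hμ0⟩ := exists_multiplier_of_isDualOn (hab.mono hBA) (J := (J : Set ι))
    (g := fun i x => ⟪a i, x⟫_ℝ) (x₀ := d) (fun i _ => (innerSL ℝ (a i)).hasStrictFDerivAt)
    (fun i hi => (Finset.mem_filter.1 hi).2) hderiv hloc
  refine ⟨fun i => if i ∈ B then μ i else 0, ?_, hd, fun i hi hJ => ?_⟩
  · have : ∑ i ∈ A, (if i ∈ B then μ i else 0) • a i = ∑ i ∈ B, μ i • a i := by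
      rw [← Finset.sum_subset hBA]
      · exact Finset.sum_congr rfl fun i hi => by simp [hi]
      · intro i _ hi
        simp [hi]
    rw [this]
    have h3 : H d + ∑ i ∈ B, μ i • a i - p = 0 := by rw [← hμ]; abel
    exact (sub_eq_zero.1 h3).symm
  · by_cases hiB : i ∈ B
    · simp only [hiB, if_true]
      exact ⟨hμ0 i hiB (by simpa using hJ), by rw [(Finset.mem_filter.1 hiB).2, mul_zero]⟩
    · simp [hiB]

/-- Under positive definiteness, solutions of the critical system are Lipschitz continuous in the
tilt. -/
theorem exists_isCriticalTriple_lipschitz [DecidableEq ι] (hJA : J ⊆ A) {b : ι → E}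
    (hab : IsDualOn A a b) {c : ℝ} (hc : 0 < c)
    (hH : ∀ w, (∀ i ∈ J, ⟪a i, w⟫_ℝ = 0) → c * ‖w‖ ^ 2 ≤ ⟪H w, w⟫_ℝ) :
    ∃ K ≥ 0, ∀ (p p' d d' : E) (ν ν' : ι → ℝ), IsCriticalTriple A J a H p d ν →
      IsCriticalTriple A J a H p' d' ν' →
      ‖d - d'‖ ≤ K * ‖p - p'‖ ∧ ∑ i ∈ A, |ν i - ν' i| ≤ K * ‖p - p'‖ := by
  obtain ⟨ε, hε, K, hK, hest⟩ := exists_stability_estimate hJA hab H hc hH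
  refine ⟨K, hK, fun p p' d d' ν ν' h h' => ?_⟩
  refine hest (d - d') (p - p') 0 (fun i => ν i - ν' i) ?_ ?_ ?_ ?_
  · rw [h.eq, h'.eq, map_sub]
    simp only [sub_smul, Finset.sum_sub_distrib]
    abel
  · rw [norm_zero]
    positivity
  · intro i hi
    refine (neg_nonpos.2 (by positivity)).trans ?_
    rw [inner_sub_right]
    by_cases hJ : i ∈ J
    · rw [(h.mem i hi).2 hJ, (h'.mem i hi).2 hJ, sub_self, mul_zero]
    · have h1 := mul_nonpos_of_nonneg_of_nonpos (h.compl i hi hJ).1 (h'.mem i hi).1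
      have h2 := mul_nonpos_of_nonneg_of_nonpos (h'.compl i hi hJ).1 (h.mem i hi).1
      have h3 := (h.compl i hi hJ).2
      have h4 := (h'.compl i hi hJ).2
      linarith
  · intro i hi
    rw [inner_sub_right, (h.mem i (hJA hi)).2 hi, (h'.mem i (hJA hi)).2 hi]
    simpa using by positivity

/-- If the primal part of the critical system is Lipschitz continuous in the tilt and `H` is
nonnegative on the critical cone, then every critical direction `d` is the unique minimizer for the
tilt `H d`. The minimizers of the quadratics with Hessian `H + ε` exist, solve the critical system
for `H` with tilt `H d - ε dₑ`, and hence tend to `d`. -/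
theorem argmin_apply_self_of_isCriticalTriple_lipschitz [FiniteDimensional ℝ E] [DecidableEq ι]
    {b : ι → E} (hab : IsDualOn A a b) (hH : ∀ u v, ⟪H u, v⟫_ℝ = ⟪u, H v⟫_ℝ)
    (hnonneg : ∀ w ∈ criticalCone A J a, 0 ≤ ⟪H w, w⟫_ℝ) {κ : ℝ} (hκ : 0 ≤ κ)
    (hLip : ∀ (p p' d d' : E) (ν ν' : ι → ℝ), IsCriticalTriple A J a H p d ν →
      IsCriticalTriple A J a H p' d' ν' → ‖d - d'‖ ≤ κ * ‖p - p'‖) {d : E}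
    (hd : d ∈ criticalCone A J a) :
    (∀ x ∈ criticalCone A J a, tiltedQuadratic H (H d) d ≤ tiltedQuadratic H (H d) x) ∧
    ∀ d' ∈ criticalCone A J a,
      (∀ x ∈ criticalCone A J a, tiltedQuadratic H (H d) d' ≤ tiltedQuadratic H (H d) x) →
      d' = d := by
  constructor
  · have happrox : ∀ ε : ℝ, 0 < ε → ∃ e ∈ criticalCone A J a, ‖e - d‖ ≤ κ * (ε * ‖e‖) ∧
        ∀ x ∈ criticalCone A J a,
          tiltedQuadratic H (H d) e ≤ tiltedQuadratic H (H d) x + ε / 2 * ‖x‖ ^ 2 := by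
      intro ε hε
      set Hε : E →L[ℝ] E := H + ε • ContinuousLinearMap.id ℝ E with hHε
      have hq : ∀ x, tiltedQuadratic Hε (H d) x =
          tiltedQuadratic H (H d) x + ε / 2 * ‖x‖ ^ 2 := by
        intro x
        simp only [tiltedQuadratic, hHε, add_apply, smul_apply, ContinuousLinearMap.id_apply,
          inner_add_left, inner_smul_left, RCLike.conj_to_real, real_inner_self_eq_norm_sq]
        ring
      obtain ⟨e, he, hmin⟩ := exists_tiltedQuadratic_min (isClosed_criticalCone A J a)
        (zero_mem_criticalCone A J a) (H := Hε) hε (fun w hw => by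
          simp only [hHε, add_apply, smul_apply, ContinuousLinearMap.id_apply,
            inner_add_left, inner_smul_left, RCLike.conj_to_real, real_inner_self_eq_norm_sq]
          linarith [hnonneg w hw]) (H d)
      have hsymm : ∀ u v, ⟪Hε u, v⟫_ℝ = ⟪u, Hε v⟫_ℝ := by
        intro u v
        simp [hHε, inner_add_left, inner_add_right, inner_smul_left, inner_smul_right, hH]
      obtain ⟨ν, hν⟩ := exists_isCriticalTriple_of_min hab hsymm he hmin
      have hν' : IsCriticalTriple A J a H (H d - ε • e) e ν := by
        refine ⟨?_, hν.mem, hν.compl⟩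
        have := hν.eq
        simp only [hHε, add_apply, smul_apply, ContinuousLinearMap.id_apply] at this
        rw [sub_eq_iff_eq_add, this]
        abel
      refine ⟨e, he, ?_, fun x hx => ?_⟩
      · have h1 := hLip _ _ _ _ _ _ hν' (IsCriticalTriple.of_mem hd)
        rwa [sub_sub_cancel_left, norm_neg, norm_smul, Real.norm_of_nonneg hε.le] at h1
      · have h1 := hmin x hx
        rw [hq, hq] at h1
        have : 0 ≤ ε / 2 * ‖e‖ ^ 2 := by positivity
        linarith
    choose! e heK hed hemin using happrox
    have hlim : Tendsto e (𝓝[>] 0) (𝓝 d) := by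
      rw [tendsto_iff_norm_sub_tendsto_zero]
      have hbound : Tendsto (fun ε : ℝ => 2 * κ * ε * ‖d‖) (𝓝[>] 0) (𝓝 0) := by
        have hc : Continuous fun ε : ℝ => 2 * κ * ε * ‖d‖ := by fun_prop
        have h := (hc.tendsto 0).mono_left (nhdsWithin_le_nhds (s := Set.Ioi 0))
        simpa using h
      refine squeeze_zero' (Eventually.of_forall fun _ => norm_nonneg _) ?_ hbound
      have hsmall : (0 : ℝ) < 1 / (2 * (κ + 1)) := by positivity
      filter_upwards [Ioo_mem_nhdsGT hsmall] with ε hε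
      have h1 := hed ε hε.1
      have h2 : κ * ε ≤ 1 / 2 := by
        have := hε.2.le
        rw [le_div_iff₀ (by positivity)] at this
        nlinarith [hε.1]
      have h3 : ‖e ε‖ ≤ ‖e ε - d‖ + ‖d‖ := by
        simpa using norm_add_le (e ε - d) d
      have h4 : κ * ε * ‖e ε‖ ≤ 1 / 2 * ‖e ε‖ := by gcongr
      have h5 : ‖e ε‖ ≤ 2 * ‖d‖ := by linarith
      calc ‖e ε - d‖ ≤ κ * (ε * ‖e ε‖) := h1
        _ ≤ κ * (ε * (2 * ‖d‖)) := by have := hε.1; gcongr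
        _ = _ := by ring
    intro x hx
    have hleft := ((continuous_tiltedQuadratic H (H d)).tendsto d).comp hlim
    have hright : Tendsto (fun ε : ℝ => tiltedQuadratic H (H d) x + ε / 2 * ‖x‖ ^ 2) (𝓝[>] 0)
        (𝓝 (tiltedQuadratic H (H d) x)) := by
      have hc : Continuous fun ε : ℝ => tiltedQuadratic H (H d) x + ε / 2 * ‖x‖ ^ 2 := by fun_prop
      have h := (hc.tendsto 0).mono_left (nhdsWithin_le_nhds (s := Set.Ioi 0))
      simpa using h
    refine le_of_tendsto_of_tendsto hleft hright ?_
    filter_upwards [self_mem_nhdsWithin] with ε hε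
    exact hemin ε hε x hx
  · intro d' hd' hmin
    obtain ⟨ν, hν⟩ := exists_isCriticalTriple_of_min hab hH hd' hmin
    have h := hLip _ _ _ _ _ _ hν (IsCriticalTriple.of_mem hd)
    rw [sub_self, norm_zero, mul_zero] at h
    exact sub_eq_zero.1 (norm_le_zero_iff.1 h)

end CriticalTriple

section NormalCone

variable {n m s : ℕ}

theorem mem_normalCone_kktSet {v z : PrimalDual n m} :
    v ∈ normalCone (kktSet n m s) z ↔ z ∈ kktSet n m s ∧ v.fst = 0 ∧
      ∀ i : Fin m, (s ≤ (i : ℕ) → v.snd i = 0) ∧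
        ((i : ℕ) < s → v.snd i ≤ 0 ∧ v.snd i * z.snd i = 0) := by
  constructor
  · rintro ⟨hz, hv⟩
    refine ⟨hz, ?_, fun i => ?_⟩
    · have h := hv (z + WithLp.toLp 2 (v.fst, 0)) (fun i hi => by simpa using hz i hi)
      rw [add_sub_cancel_left, WithLp.prod_inner_apply] at h
      simp only [WithLp.ofLp_fst, WithLp.ofLp_snd, inner_zero_right, add_zero,
        real_inner_self_eq_norm_sq] at h
      exact norm_eq_zero.1 (pow_eq_zero_iff two_ne_zero |>.1 (le_antisymm h (sq_nonneg _)))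
    · have hc : ∀ c : ℝ, ((i : ℕ) < s → 0 ≤ z.snd i + c) → v.snd i * c ≤ 0 := by
        intro c hc
        have h := hv (z + WithLp.toLp 2 (0, EuclideanSpace.single i c)) (fun j hj => by
          by_cases hji : j = i
          · subst hji
            simpa using hc hj
          · simpa [hji] using hz j hj)
        rw [add_sub_cancel_left, WithLp.prod_inner_apply] at h
        simpa [EuclideanSpace.inner_single_right, mul_comm] using h
      refine ⟨fun hi => ?_, fun hi => ?_⟩
      · have h := hc (v.snd i) (fun h => absurd h (not_lt.2 hi))
        exact mul_self_eq_zero.1 (le_antisymm h (mul_self_nonneg _))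
      · have h1 := hc 1 (fun h => by linarith [hz i h])
        have h2 := hc (-z.snd i) (fun _ => by simp)
        rw [mul_one] at h1
        exact ⟨h1, le_antisymm (mul_nonpos_of_nonpos_of_nonneg h1 (hz i hi)) (by linarith)⟩
  · rintro ⟨hz, h0, hv⟩
    refine ⟨hz, fun z' hz' => ?_⟩
    rw [WithLp.prod_inner_apply, WithLp.ofLp_fst, h0, inner_zero_left, zero_add,
      PiLp.inner_apply]
    refine Finset.sum_nonpos fun i _ => ?_
    simp only [WithLp.ofLp_snd, WithLp.sub_snd, PiLp.sub_apply, RCLike.inner_apply,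
      RCLike.conj_to_real]
    rcases lt_or_ge (i : ℕ) s with h | h
    · have h1 := (hv i).2 h
      have h2 := mul_nonpos_of_nonpos_of_nonneg h1.1 (hz' i h)
      linarith
    · rw [(hv i).1 h, mul_zero]

end NormalCone

/-! ### Strong regularity implies the strong second-order condition -/

section StrongRegularity

/-- A shortcut instance: the default search unfolds the product structure and is slow. -/
instance instContinuousSMulPrimalDual (n m : ℕ) : ContinuousSMul ℝ (PrimalDual n m) :=
  IsBoundedSMul.continuousSMul

theorem tendsto_add_smul_nhdsGT {E : Type*} [NormedAddCommGroup E] [NormedSpace ℝ E] (z v : E) :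
    Tendsto (fun t : ℝ => z + t • v) (𝓝[>] 0) (𝓝 z) := by
  have hc : Continuous fun t : ℝ => z + t • v := by fun_prop
  have h := (hc.tendsto 0).mono_left (nhdsWithin_le_nhds (s := Set.Ioi 0))
  simpa using h

variable {n m : ℕ} {s : ℕ} {φ₀ : EuclideanSpace ℝ (Fin n) → ℝ}
  {φ : Fin m → EuclideanSpace ℝ (Fin n) → ℝ} {xbar : EuclideanSpace ℝ (Fin n)}
  {μbar : EuclideanSpace ℝ (Fin m)} {b : Fin m → EuclideanSpace ℝ (Fin n)}
  {H : EuclideanSpace ℝ (Fin n) →L[ℝ] EuclideanSpace ℝ (Fin n)}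

namespace IsRegularKKT

theorem exists_hasFDerivAt_kktMap (hR : IsRegularKKT s φ₀ φ xbar μbar b H) :
    ∃ A : PrimalDual n m →L[ℝ] PrimalDual n m,
      HasFDerivAt (kktMap φ₀ φ) A (WithLp.toLp 2 (xbar, μbar)) ∧
      ∀ z, (A z).fst = H z.fst + ∑ i, z.snd i • gradient (φ i) xbar ∧
        ∀ i, (A z).snd i = -⟪gradient (φ i) xbar, z.fst⟫_ℝ := by
  set zbar : PrimalDual n m := WithLp.toLp 2 (xbar, μbar) with hz
  let X : PrimalDual n m →L[ℝ] EuclideanSpace ℝ (Fin n) := WithLp.fstL 2 ℝ _ _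
  let Y : Fin m → PrimalDual n m →L[ℝ] ℝ := fun i =>
    (EuclideanSpace.proj i : EuclideanSpace ℝ (Fin m) →L[ℝ] ℝ).comp (WithLp.sndL 2 ℝ _ _)
  obtain ⟨e, he⟩ : ∃ e : (EuclideanSpace ℝ (Fin n) × (Fin m → ℝ)) →L[ℝ] PrimalDual n m,
      ∀ v, e v = WithLp.toLp 2 (v.1, WithLp.toLp 2 v.2) :=
    ⟨((WithLp.prodContinuousLinearEquiv 2 ℝ (EuclideanSpace ℝ (Fin n))
      (EuclideanSpace ℝ (Fin m))).symm : _ →L[ℝ] PrimalDual n m).comp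
      ((ContinuousLinearMap.id ℝ (EuclideanSpace ℝ (Fin n))).prodMap
        ((EuclideanSpace.equiv (Fin m) ℝ).symm : (Fin m → ℝ) →L[ℝ] EuclideanSpace ℝ (Fin m))),
      fun _ => rfl⟩
  have hX : HasFDerivAt (fun z : PrimalDual n m => z.fst) X zbar := X.hasFDerivAt
  have hY : ∀ i, HasFDerivAt (fun z : PrimalDual n m => z.snd i) (Y i) zbar := fun i =>
    (Y i).hasFDerivAt
  -- Writing the gradient of the Lagrangian around `μ̄` avoids naming the Hessians of the `φ i`.
  have h1 : HasFDerivAt (fun z : PrimalDual n m =>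
      (gradient φ₀ z.fst + ∑ i, μbar i • gradient (φ i) z.fst) +
        ∑ i, (z.snd i - μbar i) • gradient (φ i) z.fst)
      (H.comp X + ∑ i, (Y i).smulRight (gradient (φ i) xbar)) zbar := by
    have h0 : HasFDerivAt (fun z : PrimalDual n m =>
        gradient φ₀ z.fst + ∑ i, μbar i • gradient (φ i) z.fst) (H.comp X) zbar :=
      HasFDerivAt.comp (g := fun x => gradient φ₀ x + ∑ i, μbar i • gradient (φ i) x) zbar
        hR.hessian.hasFDerivAt hX
    refine h0.add (HasFDerivAt.fun_sum fun i _ => ?_)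
    obtain ⟨Hi, hHi⟩ := (hR.smooth i).2
    have h := ((hY i).sub_const (μbar i)).smul (hHi.hasFDerivAt.comp zbar hX)
    refine h.congr_fderiv ?_
    ext1 v
    simp [hz]
  have h2 : HasFDerivAt (fun z : PrimalDual n m => fun i => -φ i z.fst)
      (ContinuousLinearMap.pi fun i => -(innerSL ℝ (gradient (φ i) xbar)).comp X) zbar :=
    hasFDerivAt_pi.2 fun i =>
      ((hR.smooth i).hasStrictFDerivAt.hasFDerivAt.comp zbar hX).neg
  have h3 : HasFDerivAt (fun z : PrimalDual n m =>
      e ((gradient φ₀ z.fst + ∑ i, μbar i • gradient (φ i) z.fst) +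
        ∑ i, (z.snd i - μbar i) • gradient (φ i) z.fst, fun i => -φ i z.fst))
      (e.comp ((H.comp X + ∑ i, (Y i).smulRight (gradient (φ i) xbar)).prod
        (ContinuousLinearMap.pi fun i => -(innerSL ℝ (gradient (φ i) xbar)).comp X))) zbar :=
    e.hasFDerivAt.comp zbar (h1.prodMk h2)
  refine ⟨_, h3.congr_of_eventuallyEq ?_, fun z => ⟨?_, fun i => ?_⟩⟩
  · have hcont : Tendsto (fun z : PrimalDual n m => z.fst) (𝓝 zbar) (𝓝 xbar) := hX.continuousAt
    filter_upwards [hcont.eventually hR.eventually_hasFDerivAt_lagrangian] with z hzz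
    have hg : gradient φ₀ z.fst + ∑ i, z.snd i • gradient (φ i) z.fst =
        (gradient φ₀ z.fst + ∑ i, μbar i • gradient (φ i) z.fst) +
        ∑ i, (z.snd i - μbar i) • gradient (φ i) z.fst := by
      simp only [sub_smul, Finset.sum_sub_distrib]
      abel
    rw [he, kktMap, gradient_eq_of_hasFDerivAt (hzz z.snd), hg]
  · rw [ContinuousLinearMap.comp_apply, he]
    simp [X, Y]
  · rw [ContinuousLinearMap.comp_apply, he]
    simp [X]

theorem kktMap_self (hR : IsRegularKKT s φ₀ φ xbar μbar b H) :
    (kktMap φ₀ φ (WithLp.toLp 2 (xbar, μbar))).fst = 0 ∧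
      ∀ i, (kktMap φ₀ φ (WithLp.toLp 2 (xbar, μbar))).snd i = -φ i xbar := by
  refine ⟨?_, fun i => rfl⟩
  have h := gradient_eq_of_hasFDerivAt (hR.eventually_hasFDerivAt_lagrangian.self_of_nhds μbar)
  rw [hR.multiplier.1] at h
  exact h

theorem solvesVI (hR : IsRegularKKT s φ₀ φ xbar μbar b H) :
    SolvesVI (kktMap φ₀ φ) (kktSet n m s) (WithLp.toLp 2 (xbar, μbar)) := by
  unfold SolvesVI
  rw [mem_normalCone_kktSet]
  refine ⟨fun i hi => (hR.multiplier.2 i hi).1, ?_, fun i => ?_⟩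
  · rw [WithLp.neg_fst, hR.kktMap_self.1, neg_zero]
  · rw [WithLp.neg_snd, PiLp.neg_apply, hR.kktMap_self.2, neg_neg]
    refine ⟨(hR.feasible i).2, fun hi => ⟨(hR.feasible i).1 hi, ?_⟩⟩
    rw [mul_comm]
    exact (hR.multiplier.2 i hi).2

/-- A primal shift which absorbs the right-hand side perturbation `q` of the active constraints. -/
noncomputable def constraintShift (φ : Fin m → EuclideanSpace ℝ (Fin n) → ℝ)
    (x : EuclideanSpace ℝ (Fin n)) (b : Fin m → EuclideanSpace ℝ (Fin n)) :
    EuclideanSpace ℝ (Fin m) →L[ℝ] EuclideanSpace ℝ (Fin n) :=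
  -∑ i ∈ activeSet φ x,
    (EuclideanSpace.proj i : EuclideanSpace ℝ (Fin m) →L[ℝ] ℝ).smulRight (b i)

theorem inner_constraintShift (hR : IsRegularKKT s φ₀ φ xbar μbar b H)
    (q : EuclideanSpace ℝ (Fin m)) {i : Fin m} (hi : i ∈ activeSet φ xbar) :
    ⟪gradient (φ i) xbar, constraintShift φ xbar b q⟫_ℝ = -q i := by
  have : constraintShift φ xbar b q = -∑ i ∈ activeSet φ xbar, q i • b i := by
    simp [constraintShift]
  rw [this, inner_neg_right, hR.dual.inner_sum_right _ hi]

/-- Near the reference point the linearized inclusion with perturbation `y = (p, q)` is the critical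
system with tilt `p - H e`, where the shift `e` absorbs `q`: inactive constraints stay inactive
and positive multipliers stay positive. -/
theorem eventually_linearized_iff (hR : IsRegularKKT s φ₀ φ xbar μbar b H)
    {A : PrimalDual n m →L[ℝ] PrimalDual n m}
    (hA : ∀ z, (A z).fst = H z.fst + ∑ i, z.snd i • gradient (φ i) xbar ∧
        ∀ i, (A z).snd i = -⟪gradient (φ i) xbar, z.fst⟫_ℝ) :
    ∀ᶠ yz : PrimalDual n m × PrimalDual n m in 𝓝 (0, WithLp.toLp 2 (xbar, μbar)),
      yz.1 - (kktMap φ₀ φ (WithLp.toLp 2 (xbar, μbar)) +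
        A (yz.2 - WithLp.toLp 2 (xbar, μbar))) ∈ normalCone (kktSet n m s) yz.2 ↔
      IsCriticalTriple (activeSet φ xbar) (strictlyActiveSet s φ xbar μbar)
        (fun i => gradient (φ i) xbar) H
        (yz.1.fst - H (constraintShift φ xbar b yz.1.snd))
        (yz.2.fst - xbar - constraintShift φ xbar b yz.1.snd)
        (fun i => yz.2.snd i - μbar i) ∧ ∀ i, i ∉ activeSet φ xbar → yz.2.snd i = 0 := by
  have hev1 : ∀ᶠ yz : PrimalDual n m × PrimalDual n m in 𝓝 (0, WithLp.toLp 2 (xbar, μbar)),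
      ∀ i, 0 < μbar i → 0 < yz.2.snd i := by
    refine eventually_all.2 fun i => ?_
    by_cases hi : 0 < μbar i
    · have hc : Continuous fun yz : PrimalDual n m × PrimalDual n m => yz.2.snd i :=
        ((EuclideanSpace.proj i : EuclideanSpace ℝ (Fin m) →L[ℝ] ℝ).comp
          (WithLp.sndL 2 ℝ (EuclideanSpace ℝ (Fin n)) _)).continuous.comp continuous_snd
      exact ((hc.tendsto (0, WithLp.toLp 2 (xbar, μbar))).eventually_const_lt
        (show 0 < μbar i from hi)).mono fun yz h _ => h
    · simp [hi]
  have hev2 : ∀ᶠ yz : PrimalDual n m × PrimalDual n m in 𝓝 (0, WithLp.toLp 2 (xbar, μbar)),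
      ∀ i, i ∉ activeSet φ xbar →
        yz.1.snd i + φ i xbar + ⟪gradient (φ i) xbar, yz.2.fst - xbar⟫_ℝ < 0 := by
    refine eventually_all.2 fun i => ?_
    by_cases hi : i ∈ activeSet φ xbar
    · simp [hi]
    · have hneg : φ i xbar < 0 := hR.eventually_inactive_neg.self_of_nhds i hi
      have hc : Continuous fun yz : PrimalDual n m × PrimalDual n m =>
          yz.1.snd i + φ i xbar + ⟪gradient (φ i) xbar, yz.2.fst - xbar⟫_ℝ := by
        have h1 : Continuous fun yz : PrimalDual n m × PrimalDual n m => yz.1.snd i :=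
          ((EuclideanSpace.proj i : EuclideanSpace ℝ (Fin m) →L[ℝ] ℝ).comp
            (WithLp.sndL 2 ℝ (EuclideanSpace ℝ (Fin n)) _)).continuous.comp continuous_fst
        have h2 : Continuous fun yz : PrimalDual n m × PrimalDual n m => yz.2.fst :=
          (WithLp.fstL 2 ℝ (EuclideanSpace ℝ (Fin n)) (EuclideanSpace ℝ (Fin m))).continuous.comp
            continuous_snd
        fun_prop
      exact ((hc.tendsto (0, WithLp.toLp 2 (xbar, μbar))).eventually_lt_const
        (by simpa using hneg)).mono fun yz h _ => h
  filter_upwards [hev1, hev2] with yz h1 h2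
  obtain ⟨y, z⟩ := yz
  simp only at h1 h2 ⊢
  set e := constraintShift φ xbar b y.snd with he
  have hinner : ∀ i ∈ activeSet φ xbar, y.snd i + φ i xbar +
      ⟪gradient (φ i) xbar, z.fst - xbar⟫_ℝ = ⟪gradient (φ i) xbar, z.fst - xbar - e⟫_ℝ := by
    intro i hi
    rw [inner_sub_right _ (z.fst - xbar), he, hR.inner_constraintShift _ hi, mem_activeSet.1 hi]
    ring
  have hμ0 : ∀ i, i ∉ activeSet φ xbar → μbar i = 0 := fun i hi =>
    hR.multiplier.eq_zero hR.feasible hi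
  have hfst : (y - (kktMap φ₀ φ (WithLp.toLp 2 (xbar, μbar)) +
      A (z - WithLp.toLp 2 (xbar, μbar)))).fst =
      y.fst - (H (z.fst - xbar) + ∑ i, (z.snd i - μbar i) • gradient (φ i) xbar) := by
    rw [WithLp.sub_fst, WithLp.add_fst, hR.kktMap_self.1, (hA _).1, zero_add]
    simp
  have hsnd : ∀ i, (y - (kktMap φ₀ φ (WithLp.toLp 2 (xbar, μbar)) +
      A (z - WithLp.toLp 2 (xbar, μbar)))).snd i =
      y.snd i + φ i xbar + ⟪gradient (φ i) xbar, z.fst - xbar⟫_ℝ := by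
    intro i
    rw [WithLp.sub_snd, WithLp.add_snd, PiLp.sub_apply, PiLp.add_apply, hR.kktMap_self.2,
      (hA _).2]
    simp
    ring
  rw [mem_normalCone_kktSet, hfst]
  simp only [hsnd]
  have hsum : (∀ i, i ∉ activeSet φ xbar → z.snd i = 0) →
      ∑ i, (z.snd i - μbar i) • gradient (φ i) xbar =
        ∑ i ∈ activeSet φ xbar, (z.snd i - μbar i) • gradient (φ i) xbar := by
    intro h
    refine (Finset.sum_subset (Finset.subset_univ _) fun i _ hi => ?_).symm
    rw [h i hi, hμ0 i hi, sub_zero, zero_smul]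
  constructor
  · rintro ⟨hC, heq, hcompl⟩
    have hzero : ∀ i, i ∉ activeSet φ xbar → z.snd i = 0 := fun i hi =>
      (mul_eq_zero.1 ((hcompl i).2 (lt_of_not_mem_activeSet hR.feasible hi)).2).resolve_left
        (h2 i hi).ne
    refine ⟨⟨?_, fun i hi => ?_, fun i hi hJ => ?_⟩, hzero⟩
    · rw [hsum hzero, sub_eq_zero] at heq
      rw [heq, map_sub H (z.fst - xbar) e]
      abel
    · rw [← hinner i hi]
      rcases lt_or_ge (i : ℕ) s with hs | hs
      · refine ⟨((hcompl i).2 hs).1, fun hJ => ?_⟩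
        have hpos := (mem_strictlyActiveSet.1 hJ).2.resolve_left (not_le.2 hs)
        exact (mul_eq_zero.1 ((hcompl i).2 hs).2).resolve_right (h1 i hpos).ne'
      · rw [(hcompl i).1 hs]
        simp
    · have hnot : ¬(s ≤ (i : ℕ) ∨ 0 < μbar i) := fun h =>
        hJ (mem_strictlyActiveSet.2 ⟨mem_activeSet.1 hi, h⟩)
      push Not at hnot
      have hμi : μbar i = 0 := le_antisymm hnot.2 (hR.multiplier.2 i hnot.1).1
      rw [← hinner i hi, hμi, sub_zero, mul_comm]
      exact ⟨hC i hnot.1, ((hcompl i).2 hnot.1).2⟩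
  · rintro ⟨⟨heq, hmem, hcompl⟩, hzero⟩
    refine ⟨fun i hi => ?_, ?_, fun i => ⟨fun hs => ?_, fun hs => ?_⟩⟩
    · by_cases hiA : i ∈ activeSet φ xbar
      · by_cases hpos : 0 < μbar i
        · exact (h1 i hpos).le
        · have hJ : i ∉ strictlyActiveSet s φ xbar μbar := fun h =>
            hpos ((mem_strictlyActiveSet.1 h).2.resolve_left (not_le.2 hi))
          have h := (hcompl i hiA hJ).1
          linarith [(hR.multiplier.2 i hi).1]
      · exact (hzero i hiA).ge
    · rw [hsum hzero, sub_eq_zero]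
      have h := sub_eq_iff_eq_add.1 heq
      rw [h, map_sub H (z.fst - xbar) e]
      abel
    · have hi := (hR.feasible i).2 hs
      rw [hinner i (mem_activeSet.2 hi)]
      exact (hmem i (mem_activeSet.2 hi)).2 (mem_strictlyActiveSet.2 ⟨hi, Or.inl hs⟩)
    · by_cases hiA : i ∈ activeSet φ xbar
      · rw [hinner i hiA]
        refine ⟨(hmem i hiA).1, ?_⟩
        by_cases hJ : i ∈ strictlyActiveSet s φ xbar μbar
        · rw [(hmem i hiA).2 hJ, zero_mul]
        · have hnot : ¬(s ≤ (i : ℕ) ∨ 0 < μbar i) := fun h =>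
            hJ (mem_strictlyActiveSet.2 ⟨mem_activeSet.1 hiA, h⟩)
          push Not at hnot
          have hμi : μbar i = 0 := le_antisymm hnot.2 (hR.multiplier.2 i hs).1
          have h := (hcompl i hiA hJ).2
          rw [hμi, sub_zero] at h
          rw [mul_comm]
          exact h
      · exact ⟨(h2 i hiA).le, by rw [hzero i hiA, mul_zero]⟩

/-- Strong regularity makes the primal part of the critical system Lipschitz continuous in the tilt,
globally by homogeneity. -/
theorem exists_isCriticalTriple_lipschitz_of_isStronglyRegular
    (hR : IsRegularKKT s φ₀ φ xbar μbar b H)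
    (h : IsStronglyRegular (kktMap φ₀ φ) (kktSet n m s) (WithLp.toLp 2 (xbar, μbar))) :
    ∃ κ : ℝ≥0, ∀ (p p' d d' : EuclideanSpace ℝ (Fin n)) (ν ν' : Fin m → ℝ),
      IsCriticalTriple (activeSet φ xbar) (strictlyActiveSet s φ xbar μbar)
        (fun i => gradient (φ i) xbar) H p d ν →
      IsCriticalTriple (activeSet φ xbar) (strictlyActiveSet s φ xbar μbar)
        (fun i => gradient (φ i) xbar) H p' d' ν' → ‖d - d'‖ ≤ κ * ‖p - p'‖ := by
  classical
  obtain ⟨-, A, hAd, U, hU, V, hV, σ, κ, hLip, hσ⟩ := h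
  have hA : ∀ z, (A z).fst = H z.fst + ∑ i, z.snd i • gradient (φ i) xbar ∧
        ∀ i, (A z).snd i = -⟪gradient (φ i) xbar, z.fst⟫_ℝ := by
    obtain ⟨A', hA', h'⟩ := hR.exists_hasFDerivAt_kktMap
    rwa [hAd.unique hA']
  refine ⟨κ, ?_⟩
  let Y : ℝ → EuclideanSpace ℝ (Fin n) → PrimalDual n m := fun t p => WithLp.toLp 2 (t • p, 0)
  let Z : ℝ → EuclideanSpace ℝ (Fin n) → (Fin m → ℝ) → PrimalDual n m := fun t d ν =>
    WithLp.toLp 2 (xbar, μbar) + t • WithLp.toLp 2 (d,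
      WithLp.toLp 2 fun i => if i ∈ activeSet φ xbar then ν i else 0)
  have hsol : ∀ (p d : EuclideanSpace ℝ (Fin n)) (ν : Fin m → ℝ),
      IsCriticalTriple (activeSet φ xbar) (strictlyActiveSet s φ xbar μbar)
        (fun i => gradient (φ i) xbar) H p d ν →
      ∀ᶠ t in 𝓝[>] (0 : ℝ), Y t p ∈ U ∧ Z t d ν = σ (Y t p) := by
    intro p d ν hT
    have hY : Tendsto (fun t => Y t p) (𝓝[>] 0) (𝓝 0) := by
      refine (tendsto_add_smul_nhdsGT 0 (WithLp.toLp 2 (p, 0) : PrimalDual n m)).congr fun t => ?_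
      rw [zero_add, ← WithLp.toLp_smul, Prod.smul_mk, smul_zero]
    have hZ : Tendsto (fun t => Z t d ν) (𝓝[>] 0) (𝓝 (WithLp.toLp 2 (xbar, μbar))) :=
      tendsto_add_smul_nhdsGT _ _
    filter_upwards [self_mem_nhdsWithin, hY hU, hZ hV,
      (hY.prodMk_nhds hZ).eventually (hR.eventually_linearized_iff hA)] with t ht h1 h2 h3
    refine ⟨h1, ?_⟩
    have hmem : Z t d ν ∈ {z ∈ V | Y t p - (kktMap φ₀ φ (WithLp.toLp 2 (xbar, μbar)) +
        A (z - WithLp.toLp 2 (xbar, μbar))) ∈ normalCone (kktSet n m s) z} := by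
      refine ⟨h2, h3.2 ⟨?_, fun i hi => ?_⟩⟩
      · have hT' := hT.smul (le_of_lt ht)
        refine ⟨?_, ?_, fun i hi hJ => ?_⟩
        · have := hT'.eq
          simp only [Y, Z, WithLp.toLp_fst, WithLp.toLp_snd, map_zero, sub_zero,
            WithLp.add_fst, WithLp.smul_fst, add_sub_cancel_left]
          rw [this]
          congr 1
          refine Finset.sum_congr rfl fun i hi => ?_
          simp [hi]
        · have := hT'.mem
          simpa [Y, Z] using this
        · have := hT'.compl i hi hJ
          simpa [Y, Z, hi] using this
      · simp [Z, hi, hR.multiplier.eq_zero hR.feasible hi]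
    rw [hσ _ h1] at hmem
    exact hmem
  intro p p' d d' ν ν' hT hT'
  obtain ⟨t, ⟨h1, h2⟩, ⟨h3, h4⟩, ht⟩ :=
    ((hsol p d ν hT).and ((hsol p' d' ν' hT').and self_mem_nhdsWithin)).exists
  have ht : 0 < t := ht
  have h5 := hLip.dist_le_mul _ h1 _ h3
  rw [← h2, ← h4, dist_eq_norm, dist_eq_norm] at h5
  have h6 : Y t p - Y t p' = WithLp.toLp 2 (t • (p - p'), 0) := by
    simp only [Y]
    rw [← WithLp.toLp_sub, Prod.mk_sub_mk, sub_zero, smul_sub]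
  have h7 : (Z t d ν - Z t d' ν').fst = t • (d - d') := by
    simp [Z, smul_sub]
  have h8 := WithLp.norm_fst_le _ (Z t d ν - Z t d' ν')
  rw [h7, norm_smul, Real.norm_of_nonneg ht.le] at h8
  rw [h6, WithLp.norm_toLp_fst, norm_smul, Real.norm_of_nonneg ht.le] at h5
  have h9 : t * ‖d - d'‖ ≤ t * (κ * ‖p - p'‖) := by linarith
  exact le_of_mul_le_mul_left h9 ht

/-- At a local minimizer, strong regularity forces the strong second-order condition. -/
theorem inner_hessian_pos_of_isStronglyRegular (hR : IsRegularKKT s φ₀ φ xbar μbar b H)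
    (hmin : IsLocalMinOn φ₀ (feasibleSet s φ) xbar)
    (h : IsStronglyRegular (kktMap φ₀ φ) (kktSet n m s) (WithLp.toLp 2 (xbar, μbar)))
    (w : EuclideanSpace ℝ (Fin n))
    (hw : ∀ i ∈ strictlyActiveSet s φ xbar μbar, ⟪gradient (φ i) xbar, w⟫_ℝ = 0) (hw0 : w ≠ 0) :
    0 < ⟪H w, w⟫_ℝ := by
  obtain ⟨κ, hκ⟩ := hR.exists_isCriticalTriple_lipschitz_of_isStronglyRegular h
  have key := fun d hd => argmin_apply_self_of_isCriticalTriple_lipschitz hR.dual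
    hR.inner_comm_hessian (fun w hw => hR.inner_hessian_nonneg hmin hw) κ.2 hκ (d := d) hd
  exact hR.inner_hessian_pos_of_argmin (fun d hd => (key d hd).1)
    (fun d hd => (key d hd).2) w hw hw0

end IsRegularKKT

end StrongRegularity

/-! ### The strong second-order condition implies strong regularity -/

section SecondOrderToStrongRegularity

variable {n m : ℕ} {s : ℕ} {φ₀ : EuclideanSpace ℝ (Fin n) → ℝ}
  {φ : Fin m → EuclideanSpace ℝ (Fin n) → ℝ} {xbar : EuclideanSpace ℝ (Fin n)}
  {μbar : EuclideanSpace ℝ (Fin m)} {b : Fin m → EuclideanSpace ℝ (Fin n)}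
  {H : EuclideanSpace ℝ (Fin n) →L[ℝ] EuclideanSpace ℝ (Fin n)}

theorem norm_le_sum_abs (x : EuclideanSpace ℝ (Fin m)) : ‖x‖ ≤ ∑ i, |x i| := by
  have h : x = ∑ i, x i • EuclideanSpace.single i (1 : ℝ) := by
    ext j
    simp [Finset.sum_apply, Pi.single_apply]
  calc ‖x‖ = ‖∑ i, x i • EuclideanSpace.single i (1 : ℝ)‖ := by rw [← h]
    _ ≤ ∑ i, ‖x i • EuclideanSpace.single i (1 : ℝ)‖ := norm_sum_le _ _
    _ = ∑ i, |x i| := by simp [norm_smul]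

theorem PrimalDual.norm_le_add (z : PrimalDual n m) : ‖z‖ ≤ ‖z.fst‖ + ‖z.snd‖ := by
  refine le_of_sq_le_sq ?_ (by positivity)
  rw [WithLp.prod_norm_sq_eq_of_L2, add_sq]
  have : 0 ≤ 2 * ‖z.fst‖ * ‖z.snd‖ := by positivity
  linarith

theorem IsCriticalTriple.congr {E ι : Type*} [NormedAddCommGroup E] [InnerProductSpace ℝ E]
    {A J : Finset ι} {a : ι → E} {H : E →L[ℝ] E} {p d : E} {ν ν' : ι → ℝ}
    (h : IsCriticalTriple A J a H p d ν) (hν : ∀ i ∈ A, ν' i = ν i) :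
    IsCriticalTriple A J a H p d ν' where
  eq := by
    rw [h.eq]
    congr 1
    exact Finset.sum_congr rfl fun i hi => by rw [hν i hi]
  mem := h.mem
  compl := fun i hi hJ => by
    rw [hν i hi]
    exact h.compl i hi hJ

/-- The strong second-order condition implies strong regularity: the critical system is solved by
minimizing a quadratic over the critical cone. -/
theorem IsRegularKKT.isStronglyRegular (hR : IsRegularKKT s φ₀ φ xbar μbar b H) {c : ℝ}
    (hc : 0 < c) (hH : ∀ w, (∀ i ∈ strictlyActiveSet s φ xbar μbar,
      ⟪gradient (φ i) xbar, w⟫_ℝ = 0) → c * ‖w‖ ^ 2 ≤ ⟪H w, w⟫_ℝ) :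
    IsStronglyRegular (kktMap φ₀ φ) (kktSet n m s) (WithLp.toLp 2 (xbar, μbar)) := by
  classical
  refine ⟨hR.solvesVI, ?_⟩
  obtain ⟨A, hAd, hA⟩ := hR.exists_hasFDerivAt_kktMap
  refine ⟨A, hAd, ?_⟩
  have hJA : strictlyActiveSet s φ xbar μbar ⊆ activeSet φ xbar := strictlyActiveSet_subset _ _
  obtain ⟨K, hK, hLip⟩ := exists_isCriticalTriple_lipschitz (H := H) hJA hR.dual hc hH
  have hex : ∀ p, ∃ w ν, IsCriticalTriple (activeSet φ xbar) (strictlyActiveSet s φ xbar μbar)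
      (fun i => gradient (φ i) xbar) H p w ν := by
    intro p
    obtain ⟨w, hw, hmin⟩ := exists_tiltedQuadratic_min (isClosed_criticalCone _ _ _)
      (zero_mem_criticalCone (activeSet φ xbar) (strictlyActiveSet s φ xbar μbar)
        (fun i => gradient (φ i) xbar)) hc
      (fun w hw => hH w fun i hi => (hw i (hJA hi)).2 hi) p
    exact ⟨w, exists_isCriticalTriple_of_min hR.dual hR.inner_comm_hessian hw hmin⟩
  choose W N hWN using hex
  let e := constraintShift φ xbar b
  let P : PrimalDual n m → EuclideanSpace ℝ (Fin n) := fun y => y.fst - H (e y.snd)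
  let ν : PrimalDual n m → EuclideanSpace ℝ (Fin m) := fun y =>
    WithLp.toLp 2 fun i => if i ∈ activeSet φ xbar then N (P y) i else 0
  let σ : PrimalDual n m → PrimalDual n m := fun y =>
    WithLp.toLp 2 (xbar + e y.snd + W (P y), μbar + ν y)
  have hμ0 : ∀ i, i ∉ activeSet φ xbar → μbar i = 0 := fun i hi =>
    hR.multiplier.eq_zero hR.feasible hi
  have hP : ∀ y y', ‖P y - P y'‖ ≤ (1 + ‖H‖ * ‖e‖) * ‖y - y'‖ := by
    intro y y'
    have h1 : P y - P y' = (y - y').fst - H (e (y - y').snd) := by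
      simp only [P, WithLp.sub_fst, WithLp.sub_snd, map_sub]
      abel
    have h2 : ‖(y - y').fst‖ ≤ ‖y - y'‖ := WithLp.norm_fst_le _ _
    have h3 : ‖(y - y').snd‖ ≤ ‖y - y'‖ := WithLp.norm_snd_le _ _
    rw [h1]
    calc ‖(y - y').fst - H (e (y - y').snd)‖
        ≤ ‖(y - y').fst‖ + ‖H‖ * (‖e‖ * ‖(y - y').snd‖) :=
          (norm_sub_le _ _).trans <| by
            gcongr
            exact (H.le_opNorm _).trans (by gcongr; exact e.le_opNorm _)
      _ ≤ ‖y - y'‖ + ‖H‖ * (‖e‖ * ‖y - y'‖) := by gcongr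
      _ = _ := by ring
  have hσLip : ∃ C : ℝ≥0, LipschitzWith C σ := by
    set C : ℝ := ‖e‖ + K * (1 + ‖H‖ * ‖e‖) + K * (1 + ‖H‖ * ‖e‖) with hC
    have hC0 : 0 ≤ C := by positivity
    refine ⟨⟨C, hC0⟩, LipschitzWith.of_dist_le_mul fun y y' => ?_⟩
    rw [dist_eq_norm, dist_eq_norm]
    obtain ⟨h1, h2⟩ := hLip _ _ _ _ _ _ (hWN (P y)) (hWN (P y'))
    have h3 : K * ‖P y - P y'‖ ≤ K * ((1 + ‖H‖ * ‖e‖) * ‖y - y'‖) := by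
      gcongr
      exact hP y y'
    have hfst : ‖(σ y - σ y').fst‖ ≤ ‖e‖ * ‖y - y'‖ + K * ‖P y - P y'‖ := by
      have h4 : (σ y - σ y').fst = e (y - y').snd + (W (P y) - W (P y')) := by
        simp only [σ, WithLp.sub_fst, WithLp.sub_snd, WithLp.toLp_fst, map_sub]
        abel
      rw [h4]
      refine (norm_add_le _ _).trans (add_le_add ((e.le_opNorm _).trans ?_) h1)
      gcongr
      exact WithLp.norm_snd_le _ _
    have hsnd : ‖(σ y - σ y').snd‖ ≤ K * ‖P y - P y'‖ := by
      refine (norm_le_sum_abs _).trans (le_trans (le_of_eq ?_) h2)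
      rw [← Finset.sum_subset (Finset.subset_univ (activeSet φ xbar))]
      · refine Finset.sum_congr rfl fun i hi => ?_
        simp [σ, ν, hi]
      · intro i _ hi
        simp [σ, ν, hi]
    calc ‖σ y - σ y'‖ ≤ _ := PrimalDual.norm_le_add _
      _ ≤ ‖e‖ * ‖y - y'‖ + K * ((1 + ‖H‖ * ‖e‖) * ‖y - y'‖) +
          K * ((1 + ‖H‖ * ‖e‖) * ‖y - y'‖) := by linarith
      _ = C * ‖y - y'‖ := by rw [hC]; ring
  obtain ⟨C, hC⟩ := hσLip
  have hσ0 : σ 0 = WithLp.toLp 2 (xbar, μbar) := by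
    have hP0 : P 0 = 0 := by simp [P]
    obtain ⟨h1, h2⟩ := hLip _ _ _ _ _ _ (hWN 0) isCriticalTriple_zero
    rw [sub_self, norm_zero, mul_zero] at h1 h2
    have h3 : W 0 = 0 := by simpa using h1
    have h4 : ∀ i ∈ activeSet φ xbar, N 0 i = 0 := by
      have h5 := (Finset.sum_eq_zero_iff_of_nonneg fun i _ => abs_nonneg _).1
        (le_antisymm h2 (Finset.sum_nonneg fun i _ => abs_nonneg _))
      intro i hi
      simpa using h5 i hi
    have h6 : ν 0 = 0 := by
      ext i
      by_cases hi : i ∈ activeSet φ xbar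
      · simp [ν, hi, hP0, h4 i hi]
      · simp [ν, hi]
    simp only [σ, hP0, h3, h6, WithLp.zero_snd, map_zero, add_zero]
  have hiff := hR.eventually_linearized_iff hA
  rw [nhds_prod_eq] at hiff
  obtain ⟨U, hU, V, hV, hUV⟩ := eventually_prod_iff.1 hiff
  refine ⟨{y | U y ∧ V (σ y)}, ?_, {z | V z}, hV, σ, C, hC.lipschitzOnWith, ?_⟩
  · have hcont : Tendsto σ (𝓝 0) (𝓝 (WithLp.toLp 2 (xbar, μbar))) := by
      have := hC.continuous.tendsto 0
      rwa [hσ0] at this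
    exact hU.and (hcont.eventually hV)
  · rintro y ⟨hyU, hyV⟩
    have hT : IsCriticalTriple (activeSet φ xbar) (strictlyActiveSet s φ xbar μbar)
        (fun i => gradient (φ i) xbar) H (P y) (W (P y)) (N (P y)) := hWN (P y)
    ext z
    simp only [Set.mem_ofPred_eq, Set.mem_singleton_iff]
    constructor
    · rintro ⟨hzV, hz⟩
      obtain ⟨h1, h2⟩ := (hUV hyU hzV).1 hz
      obtain ⟨h3, h4⟩ := hLip _ _ _ _ _ _ h1 hT
      rw [show ((y, z).1.fst - H (constraintShift φ xbar b (y, z).1.snd)) = P y from rfl,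
        sub_self, norm_zero, mul_zero] at h3 h4
      have h5 := (Finset.sum_eq_zero_iff_of_nonneg fun i _ => abs_nonneg _).1
        (le_antisymm h4 (Finset.sum_nonneg fun i _ => abs_nonneg _))
      have hfst : z.fst = xbar + e y.snd + W (P y) := by
        have h6 := sub_eq_zero.1 (norm_le_zero_iff.1 h3)
        rw [← h6]
        simp only [e]
        abel
      have hsnd : z.snd = μbar + ν y := by
        ext i
        by_cases hi : i ∈ activeSet φ xbar
        · have h6 := abs_eq_zero.1 (h5 i hi)
          simp only [ν, hi, PiLp.add_apply, if_true]
          linarith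
        · simp [ν, hi, h2 i hi, hμ0 i hi]
      calc z = WithLp.toLp 2 (z.fst, z.snd) := rfl
        _ = σ y := by rw [hfst, hsnd]
    · rintro rfl
      refine ⟨hyV, (hUV hyU hyV).2 ⟨?_, fun i hi => ?_⟩⟩
      · have h1 : (σ y).fst - xbar - e y.snd = W (P y) := by
          simp only [σ, WithLp.toLp_fst]
          abel
        change IsCriticalTriple _ _ _ H (P y) ((σ y).fst - xbar - e y.snd) _
        rw [h1]
        exact hT.congr fun i hi => by simp [σ, ν, hi]
      · simp [σ, ν, hi, hμ0 i hi]

end SecondOrderToStrongRegularity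

/-! ### Solutions of tilted Karush-Kuhn-Tucker systems -/

section SecondOrderToTilt

variable {n m : ℕ} {s : ℕ} {φ₀ : EuclideanSpace ℝ (Fin n) → ℝ}
  {φ : Fin m → EuclideanSpace ℝ (Fin n) → ℝ} {xbar : EuclideanSpace ℝ (Fin n)}
  {μbar : EuclideanSpace ℝ (Fin m)} {b : Fin m → EuclideanSpace ℝ (Fin n)}
  {H : EuclideanSpace ℝ (Fin n) →L[ℝ] EuclideanSpace ℝ (Fin n)}

/-- The Karush-Kuhn-Tucker conditions at `x` with multipliers `l` for the objective tilted by `y`. -/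
structure IsTiltedKKT (s : ℕ) (φ₀ : EuclideanSpace ℝ (Fin n) → ℝ)
    (φ : Fin m → EuclideanSpace ℝ (Fin n) → ℝ) (y x : EuclideanSpace ℝ (Fin n))
    (l : Fin m → ℝ) : Prop where
  feasible : x ∈ feasibleSet s φ
  eq : gradient φ₀ x + ∑ i, l i • gradient (φ i) x = y
  compl : ∀ i : Fin m, (i : ℕ) < s → 0 ≤ l i ∧ l i * φ i x = 0

theorem IsDualOn.linearIndependent {E ι : Type*} [NormedAddCommGroup E] [InnerProductSpace ℝ E]
    [DecidableEq ι] {A : Finset ι} {a b : ι → E} (h : IsDualOn A a b) :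
    LinearIndependent ℝ (fun i : A => a i) := by
  rw [Fintype.linearIndependent_iff]
  intro g hg i
  have h1 := h.inner_sum_left (fun j => if hj : j ∈ A then g ⟨j, hj⟩ else 0) i.2
  rw [← Finset.sum_coe_sort] at h1
  simp only [Finset.coe_mem, dif_pos, Subtype.coe_eta] at h1
  rw [hg, inner_zero_left] at h1
  exact h1.symm

theorem exists_isMultiplier_of_isLocalMinOn {f : EuclideanSpace ℝ (Fin n) → ℝ}
    {u x : EuclideanSpace ℝ (Fin n)} (hx : x ∈ feasibleSet s φ)
    (hφ : ∀ i, HasStrictFDerivAt (φ i) (innerSL ℝ (gradient (φ i) x)) x)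
    (hf : HasFDerivAt f (innerSL ℝ u) x)
    (hind : LinearIndependent ℝ fun i : activeSet φ x => gradient (φ i) x)
    (hmin : IsLocalMinOn f (feasibleSet s φ) x) :
    ∃ l : Fin m → ℝ, u + ∑ i, l i • gradient (φ i) x = 0 ∧
      ∀ i : Fin m, (i : ℕ) < s → 0 ≤ l i ∧ l i * φ i x = 0 := by
  classical
  obtain ⟨b, hb⟩ := exists_isDualOn (a := fun i => gradient (φ i) x) hind
  have hmin' : ∀ᶠ z in 𝓝 x, z ∈ feasibleSet s φ → f x ≤ f z := eventually_nhdsWithin_iff.1 hmin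
  have hneg : ∀ᶠ z in 𝓝 x, ∀ i, i ∉ activeSet φ x → φ i z < 0 := by
    refine eventually_all.2 fun i => ?_
    by_cases hi : i ∈ activeSet φ x
    · simp [hi]
    · have h : φ i x < 0 := lt_of_le_of_ne (nonpos_of_mem_feasibleSet hx i)
        fun h => hi (mem_activeSet.2 h)
      exact ((hφ i).continuousAt.eventually_lt_const h).mono fun z hz _ => hz
  obtain ⟨μ, hμ, hμ0⟩ := exists_multiplier_of_isDualOn hb (J := {i : Fin m | s ≤ (i : ℕ)})
    (fun i _ => hφ i) (fun i hi => mem_activeSet.1 hi) hf (by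
      filter_upwards [hmin', hneg] with z h1 h2 h3
      refine h1 fun i => ⟨fun _ => ?_, fun hi => ?_⟩
      · by_cases hiA : i ∈ activeSet φ x
        · exact (h3 i hiA).1
        · exact (h2 i hiA).le
      · exact (h3 i (mem_activeSet.2 ((hx i).2 hi))).2 hi)
  refine ⟨fun i => if i ∈ activeSet φ x then μ i else 0, ?_, fun i hi => ?_⟩
  · rw [← hμ]
    congr 1
    rw [← Finset.sum_subset (Finset.subset_univ (activeSet φ x))]
    · exact Finset.sum_congr rfl fun i hi => by simp [hi]
    · intro i _ hi
      simp [hi]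
  · by_cases hiA : i ∈ activeSet φ x
    · simp only [hiA, if_true]
      exact ⟨hμ0 i hiA (not_le.2 hi), by rw [mem_activeSet.1 hiA, mul_zero]⟩
    · simp [hiA]

namespace IsRegularKKT

theorem isTiltedKKT (hR : IsRegularKKT s φ₀ φ xbar μbar b H) :
    IsTiltedKKT s φ₀ φ 0 xbar μbar where
  feasible := hR.feasible
  eq := hR.multiplier.1
  compl := hR.multiplier.2

/-- Local minimizers of tilted problems near `x̄` have multipliers, since linear independence of
the active gradients persists. -/
theorem eventually_exists_isTiltedKKT (hR : IsRegularKKT s φ₀ φ xbar μbar b H) :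
    ∀ᶠ x in 𝓝 xbar, ∀ y, x ∈ feasibleSet s φ →
      IsLocalMinOn (fun z => φ₀ z - ⟪y, z⟫_ℝ) (feasibleSet s φ) x →
      ∃ l, IsTiltedKKT s φ₀ φ y x l := by
  have hgrad : ContinuousAt (fun x => fun i : activeSet φ xbar => gradient (φ i) x) xbar :=
    continuousAt_pi.2 fun i => (hR.smooth i).continuousAt_gradient
  filter_upwards [hR.smooth₀.eventually_hasStrictFDerivAt,
    eventually_all.2 fun i => (hR.smooth i).eventually_hasStrictFDerivAt,
    hgrad.eventually hR.dual.linearIndependent.eventually,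
    hR.eventually_inactive_neg] with x h0 hφ hind hneg y hx hmin
  have hsub : ∀ i ∈ activeSet φ x, i ∈ activeSet φ xbar := fun i hi => by
    by_contra h
    exact (hneg i h).ne (mem_activeSet.1 hi)
  have hind' : LinearIndependent ℝ fun i : activeSet φ x => gradient (φ i) x :=
    hind.comp (fun i : activeSet φ x => (⟨i, hsub i i.2⟩ : activeSet φ xbar))
      fun i j hij => Subtype.ext (congrArg (fun k : activeSet φ xbar => (k : Fin m)) hij)
  have hf : HasFDerivAt (fun z => φ₀ z - ⟪y, z⟫_ℝ) (innerSL ℝ (gradient φ₀ x - y)) x := by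
    refine (h0.hasFDerivAt.sub (innerSL ℝ y).hasFDerivAt).congr_fderiv ?_
    ext v
    simp
  obtain ⟨l, hl, hl'⟩ := exists_isMultiplier_of_isLocalMinOn hx hφ hf hind' hmin
  refine ⟨l, hx, ?_, hl'⟩
  rw [← sub_eq_zero, ← hl]
  abel

theorem exists_lipschitz_gradient (hR : IsRegularKKT s φ₀ φ xbar μbar b H) :
    ∃ L ≥ 0, ∀ᶠ p in 𝓝 (xbar, xbar), ∀ i,
      ‖gradient (φ i) p.1 - gradient (φ i) p.2‖ ≤ L * ‖p.1 - p.2‖ := by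
  have h : ∀ i, ∃ L ≥ 0, ∀ᶠ p in 𝓝 (xbar, xbar),
      ‖gradient (φ i) p.1 - gradient (φ i) p.2‖ ≤ L * ‖p.1 - p.2‖ := by
    intro i
    obtain ⟨Hi, hHi⟩ := (hR.smooth i).2
    obtain ⟨L, hL, hb⟩ := hHi.isBigO_sub.exists_nonneg
    exact ⟨L, hL, hb.bound⟩
  choose L hL hb using h
  refine ⟨∑ i, L i, Finset.sum_nonneg fun i _ => hL i, ?_⟩
  filter_upwards [eventually_all.2 hb] with p hp i
  refine (hp i).trans ?_
  gcongr
  exact Finset.single_le_sum (fun j _ => hL j) (Finset.mem_univ i)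

theorem eventually_strict_estimates (hR : IsRegularKKT s φ₀ φ xbar μbar b H) {δ : ℝ}
    (hδ : 0 < δ) :
    ∀ᶠ p in 𝓝 (xbar, xbar),
      ‖(gradient φ₀ p.1 + ∑ i, μbar i • gradient (φ i) p.1) -
        (gradient φ₀ p.2 + ∑ i, μbar i • gradient (φ i) p.2) - H (p.1 - p.2)‖ ≤ δ * ‖p.1 - p.2‖ ∧
      ∀ i, |φ i p.1 - φ i p.2 - ⟪gradient (φ i) xbar, p.1 - p.2⟫_ℝ| ≤ δ * ‖p.1 - p.2‖ ∧
        ‖gradient (φ i) p.2 - gradient (φ i) xbar‖ ≤ δ := by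
  have h1 := hR.hessian.isLittleO.def hδ
  have h2 := fun i => (hR.smooth i).hasStrictFDerivAt.isLittleO.def hδ
  have h3 : ∀ i, ∀ᶠ p : EuclideanSpace ℝ (Fin n) × EuclideanSpace ℝ (Fin n) in 𝓝 (xbar, xbar),
      ‖gradient (φ i) p.2 - gradient (φ i) xbar‖ ≤ δ := by
    intro i
    have h4 : ∀ᶠ x in 𝓝 xbar, ‖gradient (φ i) x - gradient (φ i) xbar‖ ≤ δ := by
      have h5 := (hR.smooth i).continuousAt_gradient.eventually
        (Metric.closedBall_mem_nhds _ hδ)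
      filter_upwards [h5] with x hx
      rwa [dist_eq_norm] at hx
    exact (continuous_snd.tendsto (xbar, xbar)).eventually h4
  filter_upwards [h1, eventually_all.2 h2, eventually_all.2 h3] with p hp1 hp2 hp3
  exact ⟨hp1, fun i => ⟨hp2 i, hp3 i⟩⟩

/-- Two solutions of tilted Karush-Kuhn-Tucker systems near `x̄` satisfy the linearized system up to
the remainder `R`. -/
theorem exists_remainder (hR : IsRegularKKT s φ₀ φ xbar μbar b H)
    {x x' y y' : EuclideanSpace ℝ (Fin n)} {l l' : Fin m → ℝ} (h : IsTiltedKKT s φ₀ φ y x l)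
    (h' : IsTiltedKKT s φ₀ φ y' x' l') (hl : ∀ i, i ∉ activeSet φ xbar → l i = 0)
    (hl' : ∀ i, i ∉ activeSet φ xbar → l' i = 0) {δ L δ' : ℝ}
    (h1 : ‖(gradient φ₀ x + ∑ i, μbar i • gradient (φ i) x) -
        (gradient φ₀ x' + ∑ i, μbar i • gradient (φ i) x') - H (x - x')‖ ≤ δ * ‖x - x'‖)
    (h2 : ∀ i, ‖gradient (φ i) x - gradient (φ i) x'‖ ≤ L * ‖x - x'‖)
    (h3 : ∀ i, ‖gradient (φ i) x' - gradient (φ i) xbar‖ ≤ δ') :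
    ∃ R, y - y' = H (x - x') + ∑ i ∈ activeSet φ xbar, (l i - l' i) • gradient (φ i) xbar + R ∧
      ‖R‖ ≤ δ * ‖x - x'‖ + (∑ i ∈ activeSet φ xbar, |l i - μbar i|) * (L * ‖x - x'‖) +
        (∑ i ∈ activeSet φ xbar, |l i - l' i|) * δ' := by
  have hμ0 : ∀ i, i ∉ activeSet φ xbar → μbar i = 0 := fun i hi =>
    hR.multiplier.eq_zero hR.feasible hi
  have hsum : ∀ u : Fin m → EuclideanSpace ℝ (Fin n), (∀ i, i ∉ activeSet φ xbar → u i = 0) →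
      ∑ i, u i = ∑ i ∈ activeSet φ xbar, u i := fun u hu =>
    (Finset.sum_subset (Finset.subset_univ _) fun i _ hi => hu i hi).symm
  refine ⟨((gradient φ₀ x + ∑ i, μbar i • gradient (φ i) x) -
      (gradient φ₀ x' + ∑ i, μbar i • gradient (φ i) x') - H (x - x')) +
      ∑ i ∈ activeSet φ xbar, (l i - μbar i) • (gradient (φ i) x - gradient (φ i) x') +
      ∑ i ∈ activeSet φ xbar, (l i - l' i) • (gradient (φ i) x' - gradient (φ i) xbar), ?_, ?_⟩
  · rw [← h.eq, ← h'.eq, hsum (fun i => l i • gradient (φ i) x) fun i hi => by simp [hl i hi],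
      hsum (fun i => l' i • gradient (φ i) x') fun i hi => by simp [hl' i hi],
      hsum (fun i => μbar i • gradient (φ i) x) fun i hi => by simp [hμ0 i hi],
      hsum (fun i => μbar i • gradient (φ i) x') fun i hi => by simp [hμ0 i hi]]
    simp only [sub_smul, smul_sub, Finset.sum_sub_distrib]
    abel
  · refine (norm_add_le _ _).trans (add_le_add ((norm_add_le _ _).trans (add_le_add h1 ?_)) ?_)
    · rw [Finset.sum_mul]
      refine norm_sum_le_of_le _ fun i _ => ?_
      rw [norm_smul, Real.norm_eq_abs]
      gcongr
      exact h2 i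
    · rw [Finset.sum_mul]
      refine norm_sum_le_of_le _ fun i _ => ?_
      rw [norm_smul, Real.norm_eq_abs]
      gcongr
      exact h3 i

/-- The multipliers of tilted problems are close to `μ̄` for points near `x̄` and small tilts. -/
theorem exists_multiplier_near (hR : IsRegularKKT s φ₀ φ xbar μbar b H) {ρ : ℝ} (hρ : 0 < ρ) :
    ∃ r > 0, ∀ x y l, ‖x - xbar‖ < r → ‖y‖ < r → IsTiltedKKT s φ₀ φ y x l →
      (∀ i, i ∉ activeSet φ xbar → l i = 0) ∧
      ∑ i ∈ activeSet φ xbar, |l i - μbar i| ≤ ρ := by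
  obtain ⟨ε, hε, B, hB, hbound⟩ := exists_multiplier_bound hR.dual H
  obtain ⟨L, hL, hLip⟩ := hR.exists_lipschitz_gradient
  have hdiag : Tendsto (fun x => (x, xbar)) (𝓝 xbar) (𝓝 (xbar, xbar)) :=
    (continuous_id.prodMk continuous_const).tendsto xbar
  obtain ⟨r₀, hr₀, hball⟩ := Metric.eventually_nhds_iff_ball.1
    (((hdiag.eventually (hR.eventually_strict_estimates hε)).and (hdiag.eventually hLip)).and
      hR.eventually_inactive_neg)
  refine ⟨min r₀ (min (ε / (L + 1)) (ρ / (2 * (B + 1)))), by positivity, ?_⟩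
  intro x y l hx hy h
  obtain ⟨⟨h1, h2⟩, h3⟩ := hball x (by
    rw [Metric.mem_ball, dist_eq_norm]; exact hx.trans_le (min_le_left _ _))
  have hl : ∀ i, i ∉ activeSet φ xbar → l i = 0 := fun i hi =>
    (mul_eq_zero.1 (h.compl i (lt_of_not_mem_activeSet hR.feasible hi)).2).resolve_right
      (h3 i hi).ne
  refine ⟨hl, ?_⟩
  obtain ⟨R, hR1, hR2⟩ := hR.exists_remainder h hR.isTiltedKKT hl
    (fun i hi => hR.multiplier.eq_zero hR.feasible hi) (δ' := 0) h1.1 h2 (by simp)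
  have hxL : L * ‖x - xbar‖ ≤ ε := by
    have h4 : ‖x - xbar‖ ≤ ε / (L + 1) :=
      (hx.trans_le ((min_le_right _ _).trans (min_le_left _ _))).le
    rw [le_div_iff₀ (by positivity)] at h4
    nlinarith [norm_nonneg (x - xbar)]
  have hN0 : 0 ≤ ∑ i ∈ activeSet φ xbar, |l i - μbar i| := Finset.sum_nonneg fun _ _ => abs_nonneg _
  have h5 := hbound _ _ R (fun i => l i - μbar i) hR1 (by
    refine hR2.trans ?_
    have := mul_le_mul_of_nonneg_left hxL hN0
    linarith)
  rw [sub_zero] at h5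
  have h6 : ‖x - xbar‖ ≤ ρ / (2 * (B + 1)) :=
    (hx.trans_le ((min_le_right _ _).trans (min_le_right _ _))).le
  have h7 : ‖y‖ ≤ ρ / (2 * (B + 1)) :=
    (hy.trans_le ((min_le_right _ _).trans (min_le_right _ _))).le
  rw [le_div_iff₀ (by positivity)] at h6 h7
  nlinarith [norm_nonneg (x - xbar), norm_nonneg y]

/-- Under the strong second-order condition, solutions of tilted Karush-Kuhn-Tucker systems near
`x̄` are Lipschitz continuous in the tilt. -/
theorem exists_isTiltedKKT_lipschitz (hR : IsRegularKKT s φ₀ φ xbar μbar b H) {c : ℝ}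
    (hc : 0 < c) (hH : ∀ w, (∀ i ∈ strictlyActiveSet s φ xbar μbar,
      ⟪gradient (φ i) xbar, w⟫_ℝ = 0) → c * ‖w‖ ^ 2 ≤ ⟪H w, w⟫_ℝ) :
    ∃ K ≥ 0, ∃ r > 0, ∀ x x' y y' l l', ‖x - xbar‖ < r → ‖x' - xbar‖ < r → ‖y‖ < r → ‖y'‖ < r →
      IsTiltedKKT s φ₀ φ y x l → IsTiltedKKT s φ₀ φ y' x' l' → ‖x - x'‖ ≤ K * ‖y - y'‖ := by
  obtain ⟨ε, hε, K, hK, hest⟩ :=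
    exists_stability_estimate (strictlyActiveSet_subset xbar μbar) hR.dual H hc hH
  obtain ⟨L, hL, hLip⟩ := hR.exists_lipschitz_gradient
  -- Multipliers within `ρ₀` of `μ̄` keep the positive components positive.
  obtain ⟨ρ₀, hρ₀, hρμ⟩ : ∃ ρ₀ > 0, ∀ i, 0 < μbar i → ρ₀ < μbar i := by
    have h : ∀ᶠ ρ in 𝓝[>] (0 : ℝ), ∀ i, 0 < μbar i → ρ < μbar i := by
      refine eventually_all.2 fun i => ?_
      by_cases hi : 0 < μbar i
      · filter_upwards [Ioo_mem_nhdsGT hi] with ρ hρ _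
        exact hρ.2
      · simp [hi]
    obtain ⟨ρ, h1, h2⟩ := (h.and self_mem_nhdsWithin).exists
    exact ⟨ρ, h2, h1⟩
  set ρ : ℝ := min ρ₀ (ε / (2 * (L + 1))) with hρ
  have hρpos : 0 < ρ := by positivity
  have hρL : ρ * L ≤ ε / 2 := by
    have h1 : ρ ≤ ε / (2 * (L + 1)) := min_le_right _ _
    rw [le_div_iff₀ (by positivity)] at h1
    nlinarith
  obtain ⟨r₁, hr₁, hnear⟩ := hR.exists_multiplier_near hρpos
  obtain ⟨r₂, hr₂, hball⟩ := Metric.eventually_nhds_iff_ball.1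
    ((hR.eventually_strict_estimates (half_pos hε)).and hLip)
  refine ⟨K, hK, min r₁ r₂, lt_min hr₁ hr₂, ?_⟩
  intro x x' y y' l l' hx hx' hy hy' h h'
  obtain ⟨hl, hlρ⟩ := hnear x y l (hx.trans_le (min_le_left _ _)) (hy.trans_le (min_le_left _ _)) h
  obtain ⟨hl', hlρ'⟩ :=
    hnear x' y' l' (hx'.trans_le (min_le_left _ _)) (hy'.trans_le (min_le_left _ _)) h'
  obtain ⟨h1, h2⟩ := hball (x, x') (by
    rw [Metric.mem_ball, Prod.dist_eq, max_lt_iff, dist_eq_norm, dist_eq_norm]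
    exact ⟨hx.trans_le (min_le_right _ _), hx'.trans_le (min_le_right _ _)⟩)
  simp only at h1 h2
  obtain ⟨R, hR1, hR2⟩ := hR.exists_remainder h h' hl hl' h1.1 h2 fun i => (h1.2 i).2
  have hd := norm_nonneg (x - x')
  have hactive : ∀ i ∈ strictlyActiveSet s φ xbar μbar, φ i x = 0 ∧ φ i x' = 0 := by
    intro i hi
    have hiA := strictlyActiveSet_subset _ _ hi
    rcases lt_or_ge (i : ℕ) s with hs | hs
    · have hpos := (mem_strictlyActiveSet.1 hi).2.resolve_left (not_le.2 hs)
      have hμi : ρ < μbar i := (min_le_left _ _).trans_lt (hρμ i hpos)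
      have hpos' : ∀ k : Fin m → ℝ, ∑ i ∈ activeSet φ xbar, |k i - μbar i| ≤ ρ → 0 < k i := by
        intro k hk
        have h3 := Finset.single_le_sum (f := fun j => |k j - μbar j|)
          (fun j _ => abs_nonneg _) hiA
        have h4 := (abs_le.1 (h3.trans hk)).1
        linarith
      exact ⟨(mul_eq_zero.1 (h.compl i hs).2).resolve_left (hpos' l hlρ).ne',
        (mul_eq_zero.1 (h'.compl i hs).2).resolve_left (hpos' l' hlρ').ne'⟩
    · exact ⟨(h.feasible i).2 hs, (h'.feasible i).2 hs⟩
  have hN0 : 0 ≤ ∑ i ∈ activeSet φ xbar, |l i - l' i| := Finset.sum_nonneg fun _ _ => abs_nonneg _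
  refine (hest (x - x') (y - y') R (fun i => l i - l' i) hR1 ?_ ?_ ?_).1
  · refine hR2.trans ?_
    have h3 : (∑ i ∈ activeSet φ xbar, |l i - μbar i|) * (L * ‖x - x'‖) ≤ ε / 2 * ‖x - x'‖ := by
      rw [← mul_assoc]
      gcongr
      exact (mul_le_mul_of_nonneg_right hlρ hL).trans hρL
    have h4 : 0 ≤ ε * ∑ i ∈ activeSet φ xbar, |l i - l' i| := by positivity
    linarith
  · intro i hi
    -- Complementarity makes the multiplier and constraint increments monotone.
    have h3 : 0 ≤ (l i - l' i) * (φ i x - φ i x') := by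
      rcases lt_or_ge (i : ℕ) s with hs | hs
      · have h4 := mul_nonpos_of_nonneg_of_nonpos (h.compl i hs).1 ((h'.feasible i).1 hs)
        have h5 := mul_nonpos_of_nonneg_of_nonpos (h'.compl i hs).1 ((h.feasible i).1 hs)
        have h6 := (h.compl i hs).2
        have h7 := (h'.compl i hs).2
        linarith
      · rw [(h.feasible i).2 hs, (h'.feasible i).2 hs, sub_self, mul_zero]
    have h4 : (l i - l' i) * (φ i x - φ i x' - ⟪gradient (φ i) xbar, x - x'⟫_ℝ) ≤
        |l i - l' i| * (ε / 2 * ‖x - x'‖) := by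
      refine (le_abs_self _).trans ?_
      rw [abs_mul]
      gcongr
      exact (h1.2 i).1
    have h5 : 0 ≤ ε * (|l i - l' i| * ‖x - x'‖) := by positivity
    linarith
  · intro i hi
    have h3 := (h1.2 i).1
    rw [(hactive i hi).1, (hactive i hi).2, sub_self, zero_sub, abs_neg] at h3
    refine h3.trans ?_
    have : 0 ≤ ε * ‖x - x'‖ := by positivity
    linarith

end IsRegularKKT

end SecondOrderToTilt

/-! ### The strong second-order condition implies tilt stability -/

section TiltStability

variable {n m : ℕ} {s : ℕ} {φ₀ : EuclideanSpace ℝ (Fin n) → ℝ}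
  {φ : Fin m → EuclideanSpace ℝ (Fin n) → ℝ} {xbar : EuclideanSpace ℝ (Fin n)}
  {μbar : EuclideanSpace ℝ (Fin m)} {b : Fin m → EuclideanSpace ℝ (Fin n)}
  {H : EuclideanSpace ℝ (Fin n) →L[ℝ] EuclideanSpace ℝ (Fin n)}

theorem isCompact_feasibleSet_inter_closedBall {x : EuclideanSpace ℝ (Fin n)} {γ : ℝ}
    (hφ : ∀ i, ContinuousOn (φ i) (Metric.closedBall x γ)) :
    IsCompact (Metric.closedBall x γ ∩ feasibleSet s φ) := by
  refine (isCompact_closedBall x γ).of_isClosed_subset ?_ Set.inter_subset_left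
  have h : Metric.closedBall x γ ∩ feasibleSet s φ = Metric.closedBall x γ ∩
      ⋂ i, (Metric.closedBall x γ ∩ φ i ⁻¹' (if (i : ℕ) < s then Set.Iic 0 else {0})) := by
    ext z
    simp only [Set.mem_inter_iff, Set.mem_iInter, Set.mem_preimage, feasibleSet]
    refine and_congr_right fun hz => forall_congr' fun i => ?_
    by_cases hi : (i : ℕ) < s
    · simp [hi, hz, not_le.2 hi]
    · simp [hi, hz, not_lt.1 hi]
  rw [h]
  refine Metric.isClosed_closedBall.inter (isClosed_iInter fun i => ?_)
  refine (hφ i).preimage_isClosed_of_isClosed Metric.isClosed_closedBall ?_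
  split_ifs
  · exact isClosed_Iic
  · exact isClosed_singleton

/-- If `x₀` is the unique minimizer of `f` over a compact set, then under small tilts no point of the
sphere of radius `γ` does as well as `x₀`. -/
theorem exists_tilt_bound {E : Type*} [NormedAddCommGroup E] [InnerProductSpace ℝ E] {X : Set E}
    (hX : IsCompact X) {f : E → ℝ} (hf : ContinuousOn f X) {x₀ : E} {γ : ℝ}
    (hγ : 0 < γ) (huniq : ∀ x ∈ X, f x ≤ f x₀ → x = x₀) :
    ∃ δ > 0, ∀ y, ‖y‖ < δ → ∀ x ∈ X, ‖x - x₀‖ ≤ γ →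
      f x - ⟪y, x - x₀⟫_ℝ ≤ f x₀ → ‖x - x₀‖ < γ := by
  set S : Set E := X ∩ Metric.sphere x₀ γ with hS
  have hScomp : IsCompact S := hX.inter_right Metric.isClosed_sphere
  rcases S.eq_empty_or_nonempty with hemp | hne
  · refine ⟨1, one_pos, fun y _ x hx hxγ _ => lt_of_le_of_ne hxγ fun h => ?_⟩
    have : x ∈ S := ⟨hx, by rw [Metric.mem_sphere, dist_eq_norm]; exact h⟩
    rw [hemp] at this
    exact this
  · obtain ⟨z, hz, hzmin⟩ := hScomp.exists_isMinOn hne (hf.mono Set.inter_subset_left)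
    have hlt : f x₀ < f z := by
      by_contra h
      have h1 := huniq z hz.1 (not_lt.1 h)
      have h2 := hz.2
      rw [h1, Metric.mem_sphere, dist_self] at h2
      exact hγ.ne h2
    refine ⟨(f z - f x₀) / γ, div_pos (sub_pos.2 hlt) hγ, fun y hy x hx hxγ hle => ?_⟩
    refine lt_of_le_of_ne hxγ fun h => ?_
    have h1 : f z ≤ f x := hzmin ⟨hx, by rw [Metric.mem_sphere, dist_eq_norm]; exact h⟩
    have h2 : ⟪y, x - x₀⟫_ℝ ≤ ‖y‖ * γ := by
      rw [← h]
      exact real_inner_le_norm _ _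
    rw [lt_div_iff₀ hγ] at hy
    linarith

/-- At a local minimizer, the strong second-order condition implies tilt stability. -/
theorem IsRegularKKT.isTiltStableLocalMin (hR : IsRegularKKT s φ₀ φ xbar μbar b H)
    (hmin : IsLocalMinOn φ₀ (feasibleSet s φ) xbar) {c : ℝ}
    (hc : 0 < c) (hH : ∀ w, (∀ i ∈ strictlyActiveSet s φ xbar μbar,
      ⟪gradient (φ i) xbar, w⟫_ℝ = 0) → c * ‖w‖ ^ 2 ≤ ⟪H w, w⟫_ℝ) :
    IsTiltStableLocalMin (extendedObjective s φ₀ φ) xbar := by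
  obtain ⟨K, hK, r, hr, hLip⟩ := hR.exists_isTiltedKKT_lipschitz hc hH
  have hmin' : ∀ᶠ z in 𝓝 xbar, z ∈ feasibleSet s φ → φ₀ xbar ≤ φ₀ z :=
    eventually_nhdsWithin_iff.1 hmin
  obtain ⟨r₁, hr₁, hball⟩ := Metric.eventually_nhds_iff_ball.1
    (((hmin'.and hR.eventually_exists_isTiltedKKT).and
      hR.smooth₀.eventually_hasStrictFDerivAt).and
      (eventually_all.2 fun i => (hR.smooth i).eventually_hasStrictFDerivAt))
  set γ : ℝ := min r r₁ / 2 with hγdef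
  have hγ : 0 < γ := by positivity
  have hγr : γ < r := by
    have h := min_le_left r r₁
    have h' : 0 < min r r₁ := lt_min hr hr₁
    linarith
  have hγr₁ : γ < r₁ := by
    have h := min_le_right r r₁
    have h' : 0 < min r r₁ := lt_min hr hr₁
    linarith
  have hsub : Metric.closedBall xbar γ ⊆ Metric.ball xbar r₁ := Metric.closedBall_subset_ball hγr₁
  set X : Set (EuclideanSpace ℝ (Fin n)) := Metric.closedBall xbar γ ∩ feasibleSet s φ with hX
  have hXmem : ∀ {x}, x ∈ X ↔ ‖x - xbar‖ ≤ γ ∧ x ∈ feasibleSet s φ := by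
    intro x
    rw [hX, Set.mem_inter_iff, Metric.mem_closedBall, dist_eq_norm]
  have hXcomp : IsCompact X := isCompact_feasibleSet_inter_closedBall fun i x hx =>
    ((hball x (hsub hx)).2 i).continuousAt.continuousWithinAt
  have hφ₀ : ContinuousOn φ₀ X := fun x hx =>
    (hball x (hsub hx.1)).1.2.continuousAt.continuousWithinAt
  have hxX : xbar ∈ X := hXmem.2 ⟨by simpa using hγ.le, hR.feasible⟩
  have hKKT : ∀ y, ∀ x ∈ X, IsLocalMinOn (fun z => φ₀ z - ⟪y, z⟫_ℝ) (feasibleSet s φ) x →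
      ∃ l, IsTiltedKKT s φ₀ φ y x l := fun y x hx h =>
    (hball x (hsub hx.1)).1.1.2 y hx.2 h
  have huniq : ∀ x ∈ X, φ₀ x ≤ φ₀ xbar → x = xbar := by
    intro x hx hle
    obtain ⟨l, hl⟩ := hKKT 0 x hx (by
      filter_upwards [nhdsWithin_le_nhds (Metric.isOpen_ball.mem_nhds (hsub hx.1)),
        self_mem_nhdsWithin] with z hz hzX
      simpa using hle.trans ((hball z hz).1.1.1 hzX))
    have h := hLip x xbar 0 0 l μbar ((hXmem.1 hx).1.trans_lt hγr) (by simpa using hr)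
      (by simpa using hr) (by simpa using hr) hl hR.isTiltedKKT
    rw [sub_self, norm_zero, mul_zero] at h
    exact sub_eq_zero.1 (norm_le_zero_iff.1 h)
  obtain ⟨δ, hδ, hbound⟩ := exists_tilt_bound hXcomp hφ₀ hγ huniq
  set ρ : ℝ := min r δ with hρ
  have hρpos : 0 < ρ := lt_min hr hδ
  have hargmin : ∀ y x, x ∈ tiltArgmin (extendedObjective s φ₀ φ) xbar γ y ↔
      x ∈ X ∧ ∀ x' ∈ X, φ₀ x - ⟪y, x - xbar⟫_ℝ ≤ φ₀ x' - ⟪y, x' - xbar⟫_ℝ := by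
    intro y x
    rw [mem_tiltArgmin_extendedObjective hR.feasible hγ.le, hXmem, and_assoc]
    refine and_congr_right fun _ => and_congr_right fun _ => ?_
    exact ⟨fun h x' hx' => h x' (hXmem.1 hx').2 (hXmem.1 hx').1,
      fun h x' hx' hxγ => h x' (hXmem.2 ⟨hxγ, hx'⟩)⟩
  have hargminKKT : ∀ y x, ‖y‖ < ρ → x ∈ tiltArgmin (extendedObjective s φ₀ φ) xbar γ y →
      ‖x - xbar‖ < r ∧ ∃ l, IsTiltedKKT s φ₀ φ y x l := by
    intro y x hy hx
    obtain ⟨hxX', hxmin⟩ := (hargmin y x).1 hx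
    have hint : ‖x - xbar‖ < γ := by
      refine hbound y (hy.trans_le (min_le_right _ _)) x hxX' (hXmem.1 hxX').1 ?_
      simpa using hxmin xbar hxX
    refine ⟨hint.trans hγr, hKKT y x hxX' ?_⟩
    have hmem : x ∈ Metric.ball xbar γ := by rwa [Metric.mem_ball, dist_eq_norm]
    filter_upwards [nhdsWithin_le_nhds (Metric.isOpen_ball.mem_nhds hmem), self_mem_nhdsWithin]
      with z hz hzX
    have h := hxmin z ⟨Metric.ball_subset_closedBall hz, hzX⟩
    simp only [inner_sub_right] at h
    change φ₀ x - ⟪y, x⟫_ℝ ≤ φ₀ z - ⟪y, z⟫_ℝ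
    linarith
  have hdist : ∀ y y' x x', ‖y‖ < ρ → ‖y'‖ < ρ →
      x ∈ tiltArgmin (extendedObjective s φ₀ φ) xbar γ y →
      x' ∈ tiltArgmin (extendedObjective s φ₀ φ) xbar γ y' → ‖x - x'‖ ≤ K * ‖y - y'‖ := by
    intro y y' x x' hy hy' hx hx'
    obtain ⟨h1, l, hl⟩ := hargminKKT y x hy hx
    obtain ⟨h2, l', hl'⟩ := hargminKKT y' x' hy' hx'
    exact hLip x x' y y' l l' h1 h2 (hy.trans_le (min_le_left _ _))
      (hy'.trans_le (min_le_left _ _)) hl hl'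
  have hex : ∀ y, ∃ x, x ∈ tiltArgmin (extendedObjective s φ₀ φ) xbar γ y := by
    intro y
    obtain ⟨x, hx, hxmin⟩ := hXcomp.exists_isMinOn ⟨xbar, hxX⟩
      (f := fun x => φ₀ x - ⟪y, x - xbar⟫_ℝ) (hφ₀.sub (by fun_prop))
    exact ⟨x, (hargmin y x).2 ⟨hx, fun x' hx' => hxmin hx'⟩⟩
  choose σ hσ using hex
  have hsingle : ∀ y x, ‖y‖ < ρ → x ∈ tiltArgmin (extendedObjective s φ₀ φ) xbar γ y →
      x = σ y := by
    intro y x hy hx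
    have h := hdist y y x (σ y) hy hy hx (hσ y)
    rw [sub_self, norm_zero, mul_zero] at h
    exact sub_eq_zero.1 (norm_le_zero_iff.1 h)
  refine ⟨by simp [extendedObjective, hR.feasible], by simp [extendedObjective, hR.feasible],
    γ, hγ, Metric.ball 0 ρ, Metric.ball_mem_nhds _ hρpos, σ, ⟨K, hK⟩, ?_, ?_, ?_⟩
  · refine LipschitzOnWith.of_dist_le_mul fun y hy y' hy' => ?_
    rw [dist_eq_norm, dist_eq_norm]
    exact hdist y y' _ _ (by simpa using hy) (by simpa using hy') (hσ y) (hσ y')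
  · refine (hsingle 0 xbar (by simpa using hρpos) ((hargmin 0 xbar).2 ⟨hxX, fun x' hx' => ?_⟩)).symm
    simp only [inner_zero_left, sub_zero]
    exact (hball x' (hsub hx'.1)).1.1.1 hx'.2
  · intro y hy
    have hy' : ‖y‖ < ρ := by simpa using hy
    ext x
    rw [Set.mem_singleton_iff]
    exact ⟨hsingle y x hy', fun h => h ▸ hσ y⟩

/-- A local minimizer satisfying the constraint qualification is in the standing situation. -/
theorem exists_isRegularKKT (hfeas : xbar ∈ feasibleSet s φ)
    (hφ₀ : SmoothWithStrictGradient φ₀ xbar) (hφ : ∀ i, SmoothWithStrictGradient (φ i) xbar)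
    (hLICQ : LICQ φ xbar) (hmin : IsLocalMinOn φ₀ (feasibleSet s φ) xbar) :
    ∃ μbar b H, IsRegularKKT s φ₀ φ xbar μbar b H := by
  have hind : LinearIndependent ℝ fun i : activeSet φ xbar => gradient (φ i) xbar :=
    LinearIndependent.comp hLICQ
      (fun i : activeSet φ xbar => (⟨i, mem_activeSet.1 i.2⟩ : {i : Fin m // φ i xbar = 0}))
      fun i j hij =>
        Subtype.ext (congrArg (fun k : {i : Fin m // φ i xbar = 0} => (k : Fin m)) hij)
  obtain ⟨b, hb⟩ := exists_isDualOn (a := fun i => gradient (φ i) xbar) hind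
  obtain ⟨l, hl, hl'⟩ := exists_isMultiplier_of_isLocalMinOn hfeas
    (fun i => (hφ i).hasStrictFDerivAt) hφ₀.hasStrictFDerivAt.hasFDerivAt hind hmin
  obtain ⟨H₀, hH₀⟩ := hφ₀.2
  choose Hi hHi using fun i => (hφ i).2
  exact ⟨WithLp.toLp 2 l, b, H₀ + ∑ i, l i • Hi i, hfeas, hφ₀, hφ, ⟨hl, hl'⟩, hb,
    hH₀.add (HasStrictFDerivAt.fun_sum fun i _ => (hHi i).const_smul (l i))⟩

theorem IsRegularKKT.isMultiplier_iff (hR : IsRegularKKT s φ₀ φ xbar μbar b H)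
    (μ : EuclideanSpace ℝ (Fin m)) : IsMultiplier s φ₀ φ xbar μ ↔ μ = μbar := by
  refine ⟨fun h => ?_, fun h => h ▸ hR.multiplier⟩
  ext i
  by_cases hi : i ∈ activeSet φ xbar
  · have h1 : ∑ j ∈ activeSet φ xbar, (μ j - μbar j) • gradient (φ j) xbar = 0 := by
      rw [Finset.sum_subset (Finset.subset_univ (activeSet φ xbar))]
      · have h2 := sub_eq_zero.2 (h.1.trans hR.multiplier.1.symm)
        simp only [sub_smul, Finset.sum_sub_distrib]
        rwa [add_sub_add_left_eq_sub] at h2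
      · intro j _ hj
        rw [h.eq_zero hR.feasible hj, hR.multiplier.eq_zero hR.feasible hj, sub_self, zero_smul]
    have h3 := hR.dual.inner_sum_left (fun j => μ j - μbar j) hi
    rw [h1, inner_zero_left] at h3
    linarith
  · rw [h.eq_zero hR.feasible hi, hR.multiplier.eq_zero hR.feasible hi]

end TiltStability

end TiltNLP

theorem corollary5p3 (n m s : ℕ) (hs : s ≤ m)
    (φ₀ : EuclideanSpace ℝ (Fin n) → ℝ) (φ : Fin m → EuclideanSpace ℝ (Fin n) → ℝ)
    (xbar : EuclideanSpace ℝ (Fin n))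
    (hfeas : xbar ∈ TiltNLP.feasibleSet s φ)
    (hφ₀ : TiltNLP.SmoothWithStrictGradient φ₀ xbar)
    (hφ : ∀ i, TiltNLP.SmoothWithStrictGradient (φ i) xbar)
    (hLICQ : TiltNLP.LICQ φ xbar) :
    (TiltNLP.IsTiltStableLocalMin (TiltNLP.extendedObjective s φ₀ φ) xbar →
      IsLocalMinOn φ₀ (TiltNLP.feasibleSet s φ) xbar) ∧
    (IsLocalMinOn φ₀ (TiltNLP.feasibleSet s φ) xbar →
      ∃ μbar : EuclideanSpace ℝ (Fin m),
        (∀ μ, TiltNLP.IsMultiplier s φ₀ φ xbar μ ↔ μ = μbar) ∧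
        (TiltNLP.IsTiltStableLocalMin (TiltNLP.extendedObjective s φ₀ φ) xbar ↔
          TiltNLP.IsStronglyRegular (TiltNLP.kktMap φ₀ φ) (TiltNLP.kktSet n m s)
            (WithLp.toLp 2 (xbar, μbar)))) := by
  refine ⟨TiltNLP.isLocalMinOn_of_isTiltStableLocalMin hfeas, fun hmin => ?_⟩
  obtain ⟨μbar, b, H, hR⟩ := TiltNLP.exists_isRegularKKT hfeas hφ₀ hφ hLICQ hmin
  refine ⟨μbar, hR.isMultiplier_iff, fun h => ?_, fun h => ?_⟩
  · obtain ⟨c, hc, hH⟩ := TiltNLP.exists_quadratic_lower_bound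
      (hR.inner_hessian_pos_of_isTiltStableLocalMin h)
    exact hR.isStronglyRegular hc hH
  · obtain ⟨c, hc, hH⟩ := TiltNLP.exists_quadratic_lower_bound
      (hR.inner_hessian_pos_of_isStronglyRegular hmin h)
    exact hR.isTiltStableLocalMin hmin hc hH
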